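/- **Theorem (efficiency of variance-stabilized leverage-weighted conformal prediction).** *Setting.* Fix $p\ge 0$, $\alpha\in(0,1)$, $\sigma>0$, $\beta^*\in\mathbb R^p$ and a continuous, strictly increasing $g:[0,\infty)\to(0,\infty)$. Let $X_0,X_1,\dots$ be an exchangeable sequence of random vectors in $\mathbb R^p$ and let $\eta_0,\eta_1,\dots$ be i.i.d. real random variables with law $F_\eta$, mean $0$ and variance $1$, independent of $(X_i)_i$. At stage $n$ there are $n_1=n_1(n)$ training points (indices $i<n_1$, forming $\mathcal D_1$), $n_2=n_2(n)$ calibration points ($n_1\le i<n_1+n_2$, forming $\mathcal D_2$), and one test point, with index $n_1+n_2$, written $(X_{n+1},Y_{n+1})$. With $\mathbf X_1$ the matrix whose rows are the training features, the leverage of $x\in\mathbb R^p$ is $h_n(x)=x^\top(\mathbf X_1^\top\mathbf X_1)^{-1}x$; assume $\mathbb P(\mathbf X_1^\top\mathbf X_1\text{ invertible})\to1$ (where it is singular, put $h_n=0$). The responses are $Y_i=X_i^\top\beta^*+\sigma\sqrt{g(h_n(X_i))}\,\eta_i$. The predictor is $\hat f(x)=x^\top\hat\beta$, with $\hat\beta=\hat\beta_n$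 a measurable function of $\mathcal D_1$. For a weight $w>0$ let $\hat q_w$ be the $\lceil(1-\alpha)(n_2+1)\rceil$-th smallest of the scores $|Y_i-\hat f(X_i)|\,w(h_n(X_i))$, $i\in\mathcal D_2$, and let $$\hat{\mathcal C}_n^w(x)=\bigl[\hat f(x)-\hat q_w/w(h_n(x)),\ \hat f(x)+\hat q_w/w(h_n(x))\bigr],\qquad |\hat{\mathcal C}_n^w(x)|=2\hat q_w/w(h_n(x)).$$ Let $w^*(h)=1/\sqrt{g(h)}$; the constant weight $w\equiv1$ gives vanilla CP. *Regularity.* As $n\to\infty$: $n_1,n_2\to\infty$; (a) $\|\hat\beta-\beta^*\|=O_p(1/\sqrt{n_1})$; (b) the empirical distribution of the leverages $h_n(X_i)$, $i\in\mathcal D_2$, converges weakly, in probability, to a probability measure $F_h$; (c) the distribution function of $F_\eta$ is continuous. *Conclusions.* 1. (Conditional coverage.) The conditional coverage given the leverage of the test point tends to $1-\alpha$, in the following senses. - $\mathbb E\bigl|\mathbb P(Y_{n+1}\in\hat{\mathcal C}_n^{w^*}(X_{n+1})\mid h_n(X_{n+1}))-(1-\alpha)\bigr|\to0$. - For $F_h$-a.e.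 $h$ and every $r>0$: $\mathbb P(|h_n(X_{n+1})-h|<r)>0$ for all large $n$, and $\mathbb P\bigl(Y_{n+1}\in\hat{\mathcal C}_n^{w^*}(X_{n+1})\,\big|\,|h_n(X_{n+1})-h|<r\bigr)\to1-\alpha$. - For $F_h$-a.e. $h$: $$\sup_{x:\,h_n(x)=h}\bigl|\mathbb P(Y_{n+1}\in\hat{\mathcal C}_n^{w^*}(X_{n+1})\mid\mathcal D_1,\mathcal D_2,X_{n+1}=x)-(1-\alpha)\bigr|\to0\quad\text{in probability,}$$ where the conditional probability is the $F_\eta$-measure of the set of all $e$ with $x^\top\beta^*+\sigma\sqrt{g(h_n(x))}\,e\in\hat{\mathcal C}_n^{w^*}(x)$. 2. (Width parity.) Assume in addition that the $(1-\alpha)$-quantile of $|\eta_0|$ is unique (exactly one $q$ satisfies $\mathbb P(|\eta_0|\le q)=1-\alpha$), that $\limsup_n\mathbb E[g(h_n(X_{n+1}))]<\infty$, and that $\mathbb E[(X_{n+1}^\top(\hat\beta-\beta^*))^2]\to0$. Then for all large $n$ both expected widths are finite and the vanilla one is positive, and $$\frac{\mathbb E\,|\hat{\mathcal C}_n^{w^*}(X_{n+1})|}{\mathbb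 E\,|\hat{\mathcal C}_n^{1}(X_{n+1})|}\longrightarrow1 .$$ -/

import Mathlib

open MeasureTheory ProbabilityTheory Filter Topology
open scoped Matrix ENNReal BoundedContinuousFunction

noncomputable section

namespace LWCP

/-- Gram matrix `X₁ᵀ X₁` of the design matrix `X₁` whose rows are `x 0, …, x (m-1)`. -/
def gram {p m : ℕ} (x : Fin m → EuclideanSpace ℝ (Fin p)) : Matrix (Fin p) (Fin p) ℝ :=
  (Matrix.of fun i j => x i j)ᵀ * Matrix.of fun i j => x i j

/-- Leverage `zᵀ (X₁ᵀ X₁)⁻¹ z` of the point `z` with respect to the design `x`. -/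
def leverage {p m : ℕ} (x : Fin m → EuclideanSpace ℝ (Fin p)) (z : EuclideanSpace ℝ (Fin p)) : ℝ :=
  z.ofLp ⬝ᵥ ((gram x)⁻¹ *ᵥ z.ofLp)

/-- The `k`-th smallest of the values `s 0, …, s (m-1)` (with multiplicity), for `1 ≤ k ≤ m`. -/
def kthSmallest {m : ℕ} (k : ℕ) (s : Fin m → ℝ) : ℝ :=
  sInf {t : ℝ | k ≤ (Finset.univ.filter fun i => s i ≤ t).card}

/-- A sequence of random variables is exchangeable if permuting it does not change its law. -/
def Exchangeable {Ω E : Type*} [MeasurableSpace Ω] [MeasurableSpace E]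
    (μ : Measure Ω) (X : ℕ → Ω → E) : Prop :=
  ∀ τ : Equiv.Perm ℕ, μ.map (fun ω i => X (τ i) ω) = μ.map (fun ω i => X i ω)

/-- `Z n = O_p(a n)`. -/
def IsBigOInProbability {Ω : Type*} [MeasurableSpace Ω] (μ : Measure Ω)
    (Z : ℕ → Ω → ℝ) (a : ℕ → ℝ) : Prop :=
  ∀ ε : ℝ≥0∞, 0 < ε → ∃ M : ℝ, ∀ᶠ n in atTop, μ {ω | M * a n < |Z n ω|} ≤ ε

/-- The random variables and parameters of split conformal prediction with a linear predictor.
At stage `n` the training set `D₁` consists of the points with index `< n₁ n`, the calibration set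
`D₂` of the next `n₂ n` points, and the test point has index `n₁ n + n₂ n`. -/
structure Setup (Ω : Type*) (p : ℕ) where
  /-- features -/
  X : ℕ → Ω → EuclideanSpace ℝ (Fin p)
  /-- standardized noise -/
  η : ℕ → Ω → ℝ
  /-- true coefficient vector -/
  βstar : EuclideanSpace ℝ (Fin p)
  /-- noise level -/
  σ : ℝ
  /-- scale function, used on `[0, ∞)` only -/
  g : ℝ → ℝ
  /-- size of the training set -/
  n₁ : ℕ → ℕ
  /-- size of the calibration set -/
  n₂ : ℕ → ℕ
  /-- the training algorithm: it maps the training set to the estimated coefficient vector -/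
  fit : ∀ n, (Fin (n₁ n) → EuclideanSpace ℝ (Fin p) × ℝ) → EuclideanSpace ℝ (Fin p)

namespace Setup

variable {Ω : Type*} {p : ℕ} (S : Setup Ω p)

/-- Training design at stage `n`. -/
def design (n : ℕ) (ω : Ω) : Fin (S.n₁ n) → EuclideanSpace ℝ (Fin p) := fun i => S.X i ω

/-- The leverage function `h` at stage `n`, computed from the training design. -/
def h (n : ℕ) (ω : Ω) (z : EuclideanSpace ℝ (Fin p)) : ℝ := leverage (S.design n ω) z

/-- A response at feature vector `x` with standardized noise `e`:
`xᵀ β* + σ √(g (h x)) e`. -/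
def response (n : ℕ) (ω : Ω) (x : EuclideanSpace ℝ (Fin p)) (e : ℝ) : ℝ :=
  inner ℝ x S.βstar + S.σ * √(S.g (S.h n ω x)) * e

/-- `Y_i = X_iᵀ β* + ε_i` with `ε_i = σ √(g (h (X_i))) η_i`. -/
def Y (n i : ℕ) (ω : Ω) : ℝ := S.response n ω (S.X i ω) (S.η i ω)

/-- The coefficient vector estimated from `D₁`. -/
def βhat (n : ℕ) (ω : Ω) : EuclideanSpace ℝ (Fin p) :=
  S.fit n fun i => (S.X i ω, S.Y n i ω)

/-- The predictor `f̂ (x) = xᵀ β̂`. -/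
def fhat (n : ℕ) (ω : Ω) (x : EuclideanSpace ℝ (Fin p)) : ℝ := inner ℝ x (S.βhat n ω)

/-- The score `|y - f̂ x| * w (h x)`. -/
def score (w : ℝ → ℝ) (n : ℕ) (ω : Ω) (x : EuclideanSpace ℝ (Fin p)) (y : ℝ) : ℝ :=
  |y - S.fhat n ω x| * w (S.h n ω x)

/-- The `⌈(1-α)(n₂+1)⌉`-th smallest calibration score. -/
def qhat (w : ℝ → ℝ) (α : ℝ) (n : ℕ) (ω : Ω) : ℝ :=
  kthSmallest ⌈(1 - α) * ((S.n₂ n : ℝ) + 1)⌉₊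
    fun i : Fin (S.n₂ n) => S.score w n ω (S.X (S.n₁ n + i) ω) (S.Y n (S.n₁ n + i) ω)

/-- The prediction interval at `x`. -/
def interval (w : ℝ → ℝ) (α : ℝ) (n : ℕ) (ω : Ω) (x : EuclideanSpace ℝ (Fin p)) : Set ℝ :=
  Set.Icc (S.fhat n ω x - S.qhat w α n ω / w (S.h n ω x))
    (S.fhat n ω x + S.qhat w α n ω / w (S.h n ω x))

/-- The width of the prediction interval at `x`. -/
def width (w : ℝ → ℝ) (α : ℝ) (n : ℕ) (ω : Ω) (x : EuclideanSpace ℝ (Fin p)) : ℝ :=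
  2 * S.qhat w α n ω / w (S.h n ω x)

/-- The variance-stabilized weight `w* = 1 / √g`. -/
def wstar (t : ℝ) : ℝ := 1 / √(S.g t)

/-- Index of the test point. -/
def testIdx (n : ℕ) : ℕ := S.n₁ n + S.n₂ n

/-- Features of the test point. -/
def Xtest (n : ℕ) (ω : Ω) : EuclideanSpace ℝ (Fin p) := S.X (S.testIdx n) ω

/-- Response of the test point. -/
def Ytest (n : ℕ) (ω : Ω) : ℝ := S.Y n (S.testIdx n) ω

/-- Leverage of the test point. -/
def htest (n : ℕ) (ω : Ω) : ℝ := S.h n ω (S.Xtest n ω)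

/-- The event that the test response lies in its prediction interval. -/
def covered (w : ℝ → ℝ) (α : ℝ) (n : ℕ) : Set Ω :=
  {ω | S.Ytest n ω ∈ S.interval w α n ω (S.Xtest n ω)}

variable [MeasurableSpace Ω] (μ : Measure Ω)

/-- Conditional probability, given that `D₁ ∪ D₂` is as in `ω` and that the test feature vector
is `x`, that the test response lies in the prediction interval (the noise of the test point is
independent of everything else and distributed as `η 0`). -/
def coverageAt (w : ℝ → ℝ) (α : ℝ) (n : ℕ) (ω : Ω) (x : EuclideanSpace ℝ (Fin p)) : ℝ :=
  (μ.map (S.η 0)).real {e | S.response n ω x e ∈ S.interval w α n ω x}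

/-- Linear model with leverage-dependent scale family (the identities for `Y` and `ε` are built
into `Setup.Y`), with exchangeable features and an eventually well-defined leverage. -/
structure ScaleFamilyModel : Prop where
  measurable_X : ∀ i, Measurable (S.X i)
  measurable_η : ∀ i, Measurable (S.η i)
  measurable_fit : ∀ n, Measurable (S.fit n)
  exchangeable_X : Exchangeable μ S.X
  indep_η : iIndepFun S.η μ
  ident_η : ∀ i, IdentDistrib (S.η i) (S.η 0) μ μ
  indep_X_η : IndepFun (fun ω i => S.X i ω) (fun ω i => S.η i ω) μ
  memLp_η : MemLp (S.η 0) 2 μ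
  mean_η : ∫ ω, S.η 0 ω ∂μ = 0
  var_η : variance (S.η 0) μ = 1
  σ_pos : 0 < S.σ
  g_cont : ContinuousOn S.g (Set.Ici 0)
  g_mono : StrictMonoOn S.g (Set.Ici 0)
  g_zero : 0 < S.g 0
  gram_invertible :
    Tendsto (fun n => μ {ω | ¬ IsUnit (gram (S.design n ω))}) atTop (𝓝 0)

/-- Regularity as `n₁, n₂ → ∞` with `p` fixed: root-`n₁` consistency, weak convergence (in
probability) of the empirical leverage distribution to `Fh`, continuity of the noise cdf. -/
structure Regular (Fh : Measure ℝ) : Prop where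
  n₁_tendsto : Tendsto S.n₁ atTop atTop
  n₂_tendsto : Tendsto S.n₂ atTop atTop
  consistent : IsBigOInProbability μ (fun n ω => ‖S.βhat n ω - S.βstar‖)
    (fun n => 1 / √(S.n₁ n))
  leverage_weak : ∀ φ : ℝ →ᵇ ℝ, TendstoInMeasure μ
    (fun n ω => (∑ i : Fin (S.n₂ n), φ (S.h n ω (S.X (S.n₁ n + i) ω))) / (S.n₂ n : ℝ))
    atTop (fun _ => ∫ t, φ t ∂Fh)
  cdf_cont : Continuous (cdf (μ.map (S.η 0)))

/-- What the comparison of expected widths needs in addition: `F_{|η|}⁻¹ (1 - α)` is well defined,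
the noise variance `σ² E[g (h (X_{n+1}))]` of the test point stays bounded, and the mean squared
estimation error `E[(X_{n+1}ᵀ (β̂ - β*))²]` at the test point vanishes. -/
structure WidthRegular (α : ℝ) : Prop where
  quantile_unique : ∃! q : ℝ, cdf (μ.map fun ω => |S.η 0 ω|) q = 1 - α
  noise_variance_bounded : ∃ B : ℝ, ∀ᶠ n in atTop,
    ∫⁻ ω, ENNReal.ofReal (S.g (S.htest n ω)) ∂μ ≤ ENNReal.ofReal B
  prediction_error : Tendsto
    (fun n => ∫⁻ ω, ENNReal.ofReal ((inner ℝ (S.Xtest n ω) (S.βhat n ω - S.βstar)) ^ 2) ∂μ)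
    atTop (𝓝 0)

end Setup

end LWCP

end

/-!
The leverages of the points of an invertible design sum to at most `p`. By exchangeability the
leverage of a fresh point is therefore of order `p / n₁`: it tends to `0` in probability, and the
limiting leverage distribution is `δ₀`. Hence every continuous positive weight is asymptotically
constant, and each score `|Y i - f̂ (X i)| * w (h (X i))` is close to `c * |η i|`, where
`c = σ * √(g 0) * w 0`; the signal error drops out because `β̂` is consistent while the law of a
fresh `X i` does not change with `n`. The empirical distribution of the calibration scores thus
approaches the law of `c * |η 0|`, which forces `cdf q̂ → 1 - α`, and the coverage event agrees in
the limit with `c * |η| ≤ q` for the noise `η` of the test point, an event independent of the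
leverage.

When the quantile is unique, `q̂` itself converges, and every width tends in probability to
`2 * σ * √(g 0)` times the quantile of `|η 0|`. A quantile is controlled by the mean, so a width is
at most a constant times an average over the calibration points of a signal part, which vanishes
in `L¹`, and a noise part, which is bounded in `L²`: convergence in mean follows.
-/

noncomputable section

namespace LWCP

section Leverage

variable {p m : ℕ}

lemma gram_apply (x : Fin m → EuclideanSpace ℝ (Fin p)) (a b : Fin p) :
    gram x a b = ∑ i, x i a * x i b := by
  simp [gram, Matrix.mul_apply]

lemma posSemidef_gram (x : Fin m → EuclideanSpace ℝ (Fin p)) : (gram x).PosSemidef := by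
  simpa [gram] using Matrix.posSemidef_conjTranspose_mul_self (Matrix.of fun i j => x i j)

lemma posDef_gram {x : Fin m → EuclideanSpace ℝ (Fin p)} (hx : IsUnit (gram x)) :
    (gram x).PosDef :=
  (posSemidef_gram x).posDef_iff_isUnit.2 hx

lemma gram_comp_perm (x : Fin m → EuclideanSpace ℝ (Fin p)) (τ : Equiv.Perm (Fin m)) :
    gram (fun i => x (τ i)) = gram x := by
  ext a b
  simpa only [gram_apply] using Equiv.sum_comp τ fun i => x i a * x i b

lemma gram_eq_gram_castSucc_add (x : Fin (m + 1) → EuclideanSpace ℝ (Fin p)) :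
    gram x = gram (fun i : Fin m => x i.castSucc)
      + Matrix.vecMulVec (x (Fin.last m)).ofLp (x (Fin.last m)).ofLp := by
  ext a b
  simp [gram_apply, Fin.sum_univ_castSucc, Matrix.vecMulVec_apply]

lemma continuous_gram : Continuous (gram : (Fin m → EuclideanSpace ℝ (Fin p)) → _) := by
  refine continuous_matrix fun a b => ?_
  simp only [gram_apply]
  fun_prop

lemma leverage_nonneg (x : Fin m → EuclideanSpace ℝ (Fin p)) (z : EuclideanSpace ℝ (Fin p)) :
    0 ≤ leverage x z := by
  simpa [leverage] using (posSemidef_gram x).inv.dotProduct_mulVec_nonneg z.ofLp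

lemma eq_zero_of_leverage_eq_zero {x : Fin m → EuclideanSpace ℝ (Fin p)}
    (hx : IsUnit (gram x)) {z : EuclideanSpace ℝ (Fin p)} (hz : leverage x z = 0) : z = 0 := by
  by_contra hne
  have hpos := (posDef_gram hx).inv.dotProduct_mulVec_pos (x := z.ofLp) (by simpa using hne)
  rw [star_trivial] at hpos
  exact hpos.ne' hz

lemma leverage_comp_perm (x : Fin m → EuclideanSpace ℝ (Fin p)) (τ : Equiv.Perm (Fin m))
    (z : EuclideanSpace ℝ (Fin p)) : leverage (fun i => x (τ i)) z = leverage x z := by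
  rw [leverage, leverage, gram_comp_perm]

lemma sum_leverage_eq_trace (x : Fin m → EuclideanSpace ℝ (Fin p)) :
    ∑ j, leverage x (x j) = ((gram x)⁻¹ * gram x).trace := by
  simp only [leverage, dotProduct, Matrix.mulVec, Matrix.trace, Matrix.diag, Matrix.mul_apply,
    gram_apply, Finset.mul_sum]
  rw [Finset.sum_comm]
  refine Finset.sum_congr rfl fun a _ => ?_
  rw [Finset.sum_comm]
  exact Finset.sum_congr rfl fun b _ => Finset.sum_congr rfl fun j _ => by ring

lemma sum_leverage_le (x : Fin m → EuclideanSpace ℝ (Fin p)) : ∑ j, leverage x (x j) ≤ p := by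
  rw [sum_leverage_eq_trace]
  by_cases hx : IsUnit (gram x).det
  · simp [Matrix.nonsing_inv_mul _ hx]
  · simp [Matrix.nonsing_inv_apply_not_isUnit _ hx]

/-- Sherman–Morrison: adding `z` to a design turns its leverage `h` into `h / (1 + h)`. -/
lemma leverage_last_mul_one_add (x : Fin (m + 1) → EuclideanSpace ℝ (Fin p))
    (hx : IsUnit (gram fun i : Fin m => x i.castSucc)) :
    leverage x (x (Fin.last m)) * (1 + leverage (fun i : Fin m => x i.castSucc) (x (Fin.last m)))
      = leverage (fun i : Fin m => x i.castSucc) (x (Fin.last m)) := by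
  set y := fun i : Fin m => x i.castSucc
  set z := (x (Fin.last m)).ofLp with hz
  set h := leverage y (x (Fin.last m)) with hh
  have hGx : IsUnit (gram x).det := by
    rw [← Matrix.isUnit_iff_isUnit_det, gram_eq_gram_castSucc_add]
    refine ((posDef_gram hx).add_posSemidef ?_).isUnit
    simpa using Matrix.posSemidef_vecMulVec_self_star z
  have hmul : gram x *ᵥ ((gram y)⁻¹ *ᵥ z) = (1 + h) • z := by
    rw [gram_eq_gram_castSucc_add, Matrix.add_mulVec, Matrix.mulVec_mulVec,
      Matrix.mul_nonsing_inv _ ((Matrix.isUnit_iff_isUnit_det _).1 hx), Matrix.one_mulVec,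
      Matrix.vecMulVec_mulVec, add_smul, one_smul]
    simp [hh, leverage, hz]
  have hinv : (gram y)⁻¹ *ᵥ z = (1 + h) • ((gram x)⁻¹ *ᵥ z) := by
    rw [← Matrix.mulVec_smul, ← hmul, Matrix.mulVec_mulVec, Matrix.nonsing_inv_mul _ hGx,
      Matrix.one_mulVec]
  calc leverage x (x (Fin.last m)) * (1 + h) = z ⬝ᵥ ((1 + h) • ((gram x)⁻¹ *ᵥ z)) := by
        rw [dotProduct_smul, smul_eq_mul, mul_comm, leverage]
    _ = h := by rw [← hinv, hh, leverage]

lemma measurable_leverage :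
    Measurable fun w : (Fin m → EuclideanSpace ℝ (Fin p)) × EuclideanSpace ℝ (Fin p) =>
      leverage w.1 w.2 := by
  have hgram : Continuous fun w : (Fin m → EuclideanSpace ℝ (Fin p)) × EuclideanSpace ℝ (Fin p) =>
      gram w.1 := continuous_gram.comp continuous_fst
  have hpoint : Continuous fun w : (Fin m → EuclideanSpace ℝ (Fin p)) × EuclideanSpace ℝ (Fin p) =>
      w.2.ofLp := by fun_prop
  simp only [leverage, Matrix.inv_def, Matrix.smul_mulVec, dotProduct_smul, Ring.inverse_eq_inv',
    smul_eq_mul]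
  exact hgram.matrix_det.measurable.inv.mul
    (hpoint.dotProduct (hgram.matrix_adjugate.matrix_mulVec hpoint)).measurable

end Leverage

section OrderStatistics

variable {m k : ℕ} {s : Fin m → ℝ}

lemma kthSmallest_le_iff (hk : 1 ≤ k) (hkm : k ≤ m) {t : ℝ} :
    kthSmallest k s ≤ t ↔ k ≤ (Finset.univ.filter fun i => s i ≤ t).card := by
  set A : Set ℝ := {t | k ≤ (Finset.univ.filter fun i => s i ≤ t).card} with hA
  have hclosed : IsClosed A := by
    have hunion : A = ⋃ u ∈ Finset.univ.powersetCard k, ⋂ i ∈ u, Set.Ici (s i) := by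
      ext t
      simp only [hA, Set.mem_ofPred_eq, Finset.le_card_iff_exists_subset_card, Set.mem_iUnion,
        Finset.mem_powersetCard_univ, Set.mem_iInter, Set.mem_Ici, Finset.subset_iff,
        Finset.mem_filter_univ, exists_prop]
      simp only [and_comm]
    rw [hunion]
    exact isClosed_biUnion_finset fun u _ => isClosed_biInter fun i _ => isClosed_Ici
  have hne : A.Nonempty := by
    obtain ⟨t, ht⟩ := (Set.finite_range s).bddAbove
    refine ⟨t, ?_⟩
    rw [hA, Set.mem_ofPred_eq, Finset.filter_true_of_mem fun i _ => ht ⟨i, rfl⟩]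
    simpa using hkm
  have hbdd : BddBelow A := by
    obtain ⟨b, hb⟩ := (Set.finite_range s).bddBelow
    refine ⟨b, fun t ht => ?_⟩
    obtain ⟨i, hi⟩ := Finset.card_pos.1 (hk.trans ht)
    exact (hb ⟨i, rfl⟩).trans (Finset.mem_filter.1 hi).2
  refine ⟨fun hle => ?_, fun ht => csInf_le hbdd ht⟩
  have hmem : k ≤ (Finset.univ.filter fun i => s i ≤ kthSmallest k s).card :=
    hclosed.csInf_mem hne hbdd
  exact hmem.trans (Finset.card_le_card (Finset.monotone_filter_right _ fun i _ hi => hi.trans hle))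

/-- Outside `1 ≤ k ≤ m` the infimum is over `∅` or over `ℝ`, hence has the junk value `0`. -/
lemma kthSmallest_eq_zero (hk : ¬(1 ≤ k ∧ k ≤ m)) : kthSmallest k s = 0 := by
  rcases Nat.eq_zero_or_pos k with rfl | hpos
  · simp [kthSmallest]
  · have hempty : {t : ℝ | k ≤ (Finset.univ.filter fun i => s i ≤ t).card} = ∅ := by
      refine Set.eq_empty_of_forall_notMem fun t ht => hk ⟨hpos, le_trans ht ?_⟩
      simpa using Finset.card_le_univ (Finset.univ.filter fun i => s i ≤ t)
    rw [kthSmallest, hempty, Real.sInf_empty]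

lemma kthSmallest_nonneg (hs : ∀ i, 0 ≤ s i) : 0 ≤ kthSmallest k s := by
  by_cases hk : 1 ≤ k ∧ k ≤ m
  · obtain ⟨i, hi⟩ := Finset.card_pos.1 (hk.1.trans ((kthSmallest_le_iff hk.1 hk.2).1 le_rfl))
    exact (hs i).trans (Finset.mem_filter.1 hi).2
  · exact (kthSmallest_eq_zero hk).ge

lemma measurable_kthSmallest : Measurable (kthSmallest k : (Fin m → ℝ) → ℝ) := by
  by_cases hk : 1 ≤ k ∧ k ≤ m
  · refine measurable_of_Iic fun t => ?_
    have hpre : (kthSmallest k : (Fin m → ℝ) → ℝ) ⁻¹' Set.Iic t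
        = {s | k ≤ ∑ i, if s i ≤ t then 1 else 0} := by
      ext s
      simp [kthSmallest_le_iff hk.1 hk.2]
    rw [hpre]
    refine measurableSet_le measurable_const (Finset.measurable_sum _ fun i _ => ?_)
    exact Measurable.ite (measurableSet_le (measurable_pi_apply i) measurable_const)
      measurable_const measurable_const
  · simp only [funext fun s => kthSmallest_eq_zero (s := s) hk, measurable_const]

lemma sub_mul_kthSmallest_le_sum (hs : ∀ i, 0 ≤ s i) (hkm : k ≤ m) :
    ((m : ℝ) - k) * kthSmallest k s ≤ ∑ i, s i := by
  have hsum : 0 ≤ ∑ i, s i := Finset.sum_nonneg fun i _ => hs i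
  rcases Nat.eq_zero_or_pos k with rfl | hk
  · simpa [kthSmallest_eq_zero] using hsum
  have hmk : (0 : ℝ) ≤ m - k := sub_nonneg.2 (by exact_mod_cast hkm)
  by_contra! hlt
  set q := kthSmallest k s
  have hpos : (0 : ℝ) < m - k := hmk.lt_of_ne (by rintro h; rw [← h] at hlt; linarith)
  set t := (∑ i, s i) / (m - k) with ht
  have htq : t < q := by rwa [ht, div_lt_iff₀' hpos]
  have hbelow : (Finset.univ.filter fun i => s i ≤ t).card < k := by
    by_contra! h
    exact htq.not_ge ((kthSmallest_le_iff hk hkm).2 h)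
  have habove : (m : ℝ) - k < (Finset.univ.filter fun i => ¬ s i ≤ t).card := by
    have hsplit := Finset.card_filter_add_card_filter_not (s := (Finset.univ : Finset (Fin m)))
      (fun i => s i ≤ t)
    rw [Finset.card_fin] at hsplit
    rw [sub_lt_iff_lt_add, ← Nat.cast_add]
    exact_mod_cast (by omega : m < _ + k)
  have hlarge : ∑ i, s i < ∑ i ∈ Finset.univ.filter fun i => ¬ s i ≤ t, s i :=
    calc ∑ i, s i = (m - k) * t := by rw [ht, mul_div_cancel₀ _ hpos.ne']
      _ ≤ (Finset.univ.filter fun i => ¬ s i ≤ t).card * t :=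
        mul_le_mul_of_nonneg_right habove.le (div_nonneg hsum hmk)
      _ = ∑ _i ∈ Finset.univ.filter fun i => ¬ s i ≤ t, t := by simp
      _ < ∑ i ∈ Finset.univ.filter fun i => ¬ s i ≤ t, s i :=
        Finset.sum_lt_sum_of_nonempty (Finset.card_pos.1 (by exact_mod_cast hpos.trans habove))
          fun _ hi => not_le.1 (Finset.mem_filter.1 hi).2
  exact hlarge.not_ge (Finset.sum_le_univ_sum_of_nonneg hs)

/-- The rank of the split conformal quantile at level `1 - α` among `m` calibration scores. -/
def conformalRank (α : ℝ) (m : ℕ) : ℕ := ⌈(1 - α) * ((m : ℝ) + 1)⌉₊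

lemma tendsto_conformalRank_div {α : ℝ} (hα : α ≤ 1) :
    Tendsto (fun m : ℕ => (conformalRank α m : ℝ) / m) atTop (𝓝 (1 - α)) := by
  have hceil := ((tendsto_nat_ceil_mul_div_atTop (sub_nonneg.2 hα)).comp
    (tendsto_atTop_add_const_right atTop (1 : ℝ) tendsto_natCast_atTop_atTop))
  have hratio : Tendsto (fun m : ℕ => ((m : ℝ) + 1) / m) atTop (𝓝 1) := by
    simpa [add_comm] using tendsto_add_mul_div_add_mul_atTop_nhds (1 : ℝ) 0 1 one_ne_zero
  refine (mul_one (1 - α) ▸ hceil.mul hratio).congr fun m => ?_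
  simp only [Function.comp_apply, conformalRank]
  field_simp

lemma eventually_half_mul_le_sub_conformalRank {α : ℝ} (hα : α ∈ Set.Ioo (0 : ℝ) 1) :
    ∀ᶠ m : ℕ in atTop, α / 2 * m ≤ m - conformalRank α m := by
  have hratio := (tendsto_conformalRank_div hα.2.le).eventually_le_const
    (by linarith [hα.1] : 1 - α < 1 - α / 2)
  filter_upwards [hratio, eventually_gt_atTop 0] with m hm hpos
  have := (div_le_iff₀ (by exact_mod_cast hpos)).1 hm
  linarith

end OrderStatistics

section ConvergenceInProbability

variable {ι Ω E F : Type*} [MeasurableSpace Ω] {μ : Measure Ω} {l : Filter ι}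

lemma tendsto_measure_zero_mono {A B : ι → Set Ω} (hB : Tendsto (fun n => μ (B n)) l (𝓝 0))
    (hAB : ∀ᶠ n in l, A n ⊆ B n) : Tendsto (fun n => μ (A n)) l (𝓝 0) :=
  tendsto_of_tendsto_of_tendsto_of_le_of_le' tendsto_const_nhds hB
    (.of_forall fun _ => zero_le) (hAB.mono fun _ h => measure_mono h)

lemma tendsto_measure_zero_union {A B : ι → Set Ω} (hA : Tendsto (fun n => μ (A n)) l (𝓝 0))
    (hB : Tendsto (fun n => μ (B n)) l (𝓝 0)) :
    Tendsto (fun n => μ (A n ∪ B n)) l (𝓝 0) :=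
  tendsto_of_tendsto_of_tendsto_of_le_of_le tendsto_const_nhds (by simpa using hA.add hB)
    (fun _ => zero_le) fun _ => measure_union_le _ _

lemma tendstoInMeasure_prodMk [PseudoEMetricSpace E] [PseudoEMetricSpace F] {Y : ι → Ω → E}
    {Z : ι → Ω → F} {b : Ω → E} {c : Ω → F} (hY : TendstoInMeasure μ Y l b)
    (hZ : TendstoInMeasure μ Z l c) :
    TendstoInMeasure μ (fun n ω => (Y n ω, Z n ω)) l fun ω => (b ω, c ω) := by
  intro ε hε
  refine tendsto_measure_zero_mono (tendsto_measure_zero_union (hY ε hε) (hZ ε hε))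
    (.of_forall fun n ω hω => ?_)
  simpa [Prod.edist_eq] using hω

lemma tendstoInMeasure_comp_of_continuousAt [PseudoEMetricSpace E] [PseudoEMetricSpace F]
    {Y : ι → Ω → E} {G : E → F} {c : E} (hG : ContinuousAt G c)
    (hY : TendstoInMeasure μ Y l fun _ => c) :
    TendstoInMeasure μ (fun n ω => G (Y n ω)) l fun _ => G c := by
  intro ε hε
  obtain ⟨δ, hδ, hball⟩ := EMetric.tendsto_nhds_nhds.1 hG ε hε
  refine tendsto_measure_zero_mono (hY δ hδ) (.of_forall fun n ω hω => ?_)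
  by_contra hlt
  exact (hball (not_le.1 hlt)).not_ge hω

lemma tendstoInMeasure_of_tendstoInDistribution_const [IsProbabilityMeasure μ]
    [PseudoEMetricSpace E] [MeasurableSpace E] [OpensMeasurableSpace E] {Ω' : Type*}
    [MeasurableSpace Ω'] {ν : Measure Ω'} [IsProbabilityMeasure ν] {Y : ι → Ω → E} {c : E}
    (hY : TendstoInDistribution Y l (fun _ => c) (fun _ => μ) ν) :
    TendstoInMeasure μ Y l fun _ => c := by
  intro ε hε
  have hclosed : IsClosed {x | ε ≤ edist x c} := isClosed_le continuous_const (by fun_prop)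
  have hnull : (ν.map fun _ => c) {x | ε ≤ edist x c} = 0 := by
    simp [Measure.map_const, hclosed.measurableSet, hε.ne']
  have hlimsup := ProbabilityMeasure.limsup_measure_closed_le_of_tendsto hY.tendsto hclosed
  simp only [ProbabilityMeasure.coe_mk, hnull, nonpos_iff_eq_zero,
    fun n => Measure.map_apply_of_aemeasurable (hY.forall_aemeasurable n)
      hclosed.measurableSet] at hlimsup
  exact tendsto_of_le_liminf_of_limsup_le zero_le hlimsup.le

/-- Identically distributed variables are tight, so perturbations that vanish in probability do not
affect a continuous function of them. -/
lemma tendstoInMeasure_zero_of_hasLaw [IsProbabilityMeasure μ] [l.IsCountablyGenerated]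
    [SeminormedAddCommGroup E] [SecondCountableTopology E] [MeasurableSpace E] [BorelSpace E]
    [SeminormedAddCommGroup F] [SecondCountableTopology F] [MeasurableSpace F] [BorelSpace F]
    {ν : Measure E} {X : ι → Ω → E} {Y : ι → Ω → F} {c : F} {G : E × F → ℝ} (hG : Continuous G)
    (hGc : ∀ x, G (x, c) = 0) (hX : ∀ n, HasLaw (X n) ν μ)
    (hY : TendstoInMeasure μ Y l fun _ => c) (hYm : ∀ n, Measurable (Y n)) :
    TendstoInMeasure μ (fun n ω => G (X n ω, Y n ω)) l fun _ => 0 := by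
  rcases isEmpty_or_nonempty ι with hι | ⟨⟨n₀⟩⟩
  · intro ε _
    simp [filter_eq_bot_of_isEmpty l]
  have hlaw : TendstoInDistribution X l (X n₀) (fun _ => μ) μ :=
    tendstoInDistribution_of_identDistrib n₀ (fun n => (hX n₀).identDistrib (hX n))
      ((hX n₀).identDistrib (hX n₀))
  have hslutsky := hlaw.continuous_comp_prodMk_of_tendstoInMeasure_const hG hY
    fun n => (hYm n).aemeasurable
  simp only [hGc] at hslutsky
  exact tendstoInMeasure_of_tendstoInDistribution_const hslutsky

variable {Z : ι → Ω → ℝ} {c u : ℝ} {x : ι → ℝ}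

lemma tendsto_measure_setOf_le_of_lt (hZ : TendstoInMeasure μ Z l fun _ => c)
    (hx : Tendsto x l (𝓝 u)) (hcu : c < u) : Tendsto (fun n => μ {ω | x n ≤ Z n ω}) l (𝓝 0) := by
  refine tendsto_measure_zero_mono
    (tendstoInMeasure_iff_norm.1 hZ ((u - c) / 2) (by linarith)) ?_
  filter_upwards [hx.eventually_const_lt (show (c + u) / 2 < u by linarith)] with n hn ω hω
  have hω' : x n ≤ Z n ω := hω
  have hdiff : (u - c) / 2 ≤ Z n ω - c := by linarith
  exact hdiff.trans (le_abs_self _)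

lemma tendsto_measure_setOf_ge_of_lt (hZ : TendstoInMeasure μ Z l fun _ => c)
    (hx : Tendsto x l (𝓝 u)) (huc : u < c) : Tendsto (fun n => μ {ω | Z n ω ≤ x n}) l (𝓝 0) := by
  have hneg : TendstoInMeasure μ (fun n ω => -Z n ω) l fun _ => -c :=
    tendstoInMeasure_comp_of_continuousAt (G := fun t : ℝ => -t) (by fun_prop) hZ
  simpa only [neg_le_neg_iff] using tendsto_measure_setOf_le_of_lt hneg hx.neg (neg_lt_neg huc)

end ConvergenceInProbability

section Averages

variable {ι Ω : Type*} [MeasurableSpace Ω] {μ : Measure Ω} {l : Filter ι} {m : ι → ℕ}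

lemma lintegral_enorm_average_le {m : ℕ} {Z : Fin m → Ω → ℝ} (hZ : ∀ i, Measurable (Z i))
    {b : ℝ≥0∞} (hb : ∀ i, ∫⁻ ω, ‖Z i ω‖ₑ ∂μ ≤ b) : ∫⁻ ω, ‖(∑ i, Z i ω) / m‖ₑ ∂μ ≤ b := by
  rcases Nat.eq_zero_or_pos m with rfl | hm
  · simp
  have hpointwise : ∀ ω, ‖(∑ i, Z i ω) / m‖ₑ ≤ (m : ℝ≥0∞)⁻¹ * ∑ i, ‖Z i ω‖ₑ := fun ω => by
    rw [div_eq_inv_mul, enorm_mul, enorm_inv (by positivity), Real.enorm_natCast]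
    gcongr
    exact enorm_sum_le _ _
  calc ∫⁻ ω, ‖(∑ i, Z i ω) / m‖ₑ ∂μ ≤ (m : ℝ≥0∞)⁻¹ * ∑ i, ∫⁻ ω, ‖Z i ω‖ₑ ∂μ := by
        rw [← lintegral_finsetSum _ fun i _ => (hZ i).enorm,
          ← lintegral_const_mul _ (Finset.measurable_sum _ fun i _ => (hZ i).enorm)]
        exact lintegral_mono hpointwise
    _ ≤ (m : ℝ≥0∞)⁻¹ * ∑ _i : Fin m, b := by gcongr; exact hb _
    _ = b := by
        rw [Finset.sum_const, Finset.card_fin, nsmul_eq_mul, ← mul_assoc,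
          ENNReal.inv_mul_cancel (by positivity) (by simp), one_mul]

lemma lintegral_enorm_average_sq_le {m : ℕ} {Z : Fin m → Ω → ℝ} (hZ : ∀ i, Measurable (Z i))
    {b : ℝ≥0∞} (hb : ∀ i, ∫⁻ ω, ‖Z i ω‖ₑ ^ 2 ∂μ ≤ b) : ∫⁻ ω, ‖(∑ i, Z i ω) / m‖ₑ ^ 2 ∂μ ≤ b :=
  calc ∫⁻ ω, ‖(∑ i, Z i ω) / m‖ₑ ^ 2 ∂μ
      ≤ ∫⁻ ω, ‖(∑ i, Z i ω ^ 2) / m‖ₑ ∂μ := by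
        refine lintegral_mono fun ω => ?_
        rw [← enorm_pow, Real.enorm_of_nonneg (sq_nonneg _), Real.enorm_of_nonneg (by positivity)]
        refine ENNReal.ofReal_le_ofReal ?_
        simpa using sum_div_card_sq_le_sum_sq_div_card (s := Finset.univ) (f := fun i => Z i ω)
    _ ≤ b := lintegral_enorm_average_le (fun i => (hZ i).pow_const 2) (by simpa using hb)

lemma tendstoInMeasure_average_zero {Z : ∀ n, Fin (m n) → Ω → ℝ} (hZ : ∀ n i, Measurable (Z n i))
    {b : ι → ℝ≥0∞} (hZb : ∀ n i, ∫⁻ ω, ‖Z n i ω‖ₑ ∂μ ≤ b n) (hb : Tendsto b l (𝓝 0)) :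
    TendstoInMeasure μ (fun n ω => (∑ i, Z n i ω) / m n) l fun _ => 0 := by
  refine tendstoInMeasure_of_tendsto_eLpNorm one_ne_zero (fun n => by fun_prop)
    aestronglyMeasurable_const ?_
  refine tendsto_of_tendsto_of_tendsto_of_le_of_le tendsto_const_nhds hb (fun _ => zero_le)
    fun n => ?_
  simpa [eLpNorm_one_eq_lintegral_enorm] using lintegral_enorm_average_le (hZ n) (hZb n)

lemma tendstoInMeasure_average [IsProbabilityMeasure μ] (hm : Tendsto m l atTop)
    {Z : ∀ n, Fin (m n) → Ω → ℝ} (hL : ∀ n i, MemLp (Z n i) 2 μ)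
    (hind : ∀ n, Pairwise fun i j => Z n i ⟂ᵢ[μ] Z n j) {c v : ℝ} (hc : ∀ n i, μ[Z n i] = c)
    (hv : ∀ n i, Var[Z n i; μ] ≤ v) :
    TendstoInMeasure μ (fun n ω => (∑ i, Z n i ω) / m n) l fun _ => c := by
  rw [tendstoInMeasure_iff_norm]
  intro ε hε
  have hlim : Tendsto (fun n => ENNReal.ofReal (v / m n / ε ^ 2)) l (𝓝 0) := by
    have h := (tendsto_natCast_atTop_atTop (R := ℝ)).comp hm |>.const_div_atTop v |>.div_const
      (ε ^ 2)
    simpa using ENNReal.tendsto_ofReal h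
  refine tendsto_of_tendsto_of_tendsto_of_le_of_le' tendsto_const_nhds hlim
    (.of_forall fun _ => zero_le) ?_
  filter_upwards [hm.eventually_gt_atTop 0] with n hn
  have : (0 : ℝ) < m n := by exact_mod_cast hn
  set A : Ω → ℝ := fun ω => (∑ i, Z n i ω) / m n
  have hA : A = fun ω => (m n : ℝ)⁻¹ * (∑ i, Z n i) ω := by
    ext ω
    rw [Finset.sum_apply, ← div_eq_inv_mul]
  have hAL : MemLp A 2 μ := hA ▸ (memLp_finsetSum' _ fun i _ => hL n i).const_mul _
  have hmean : μ[A] = c := by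
    simp only [hA, Finset.sum_apply]
    rw [integral_const_mul, integral_finsetSum _ fun i _ => (hL n i).integrable one_le_two]
    simp only [hc, Finset.sum_const, Finset.card_fin, nsmul_eq_mul]
    field_simp
  have hvar : Var[A; μ] ≤ v / m n := by
    rw [hA, variance_const_mul, IndepFun.variance_sum (fun i _ => hL n i)
      fun i _ j _ hij => hind n hij]
    calc ((m n : ℝ)⁻¹) ^ 2 * ∑ i, Var[Z n i; μ] ≤ ((m n : ℝ)⁻¹) ^ 2 * ∑ _i : Fin (m n), v := by
          gcongr with i; exact hv n i
      _ = v / m n := by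
          simp only [Finset.sum_const, Finset.card_fin, nsmul_eq_mul]
          field_simp
  have hchebyshev := meas_ge_le_variance_div_sq hAL hε
  rw [hmean] at hchebyshev
  exact hchebyshev.trans (ENNReal.ofReal_le_ofReal (by gcongr))

lemma tendstoInMeasure_frequency [IsProbabilityMeasure μ] {E : Type*} [MeasurableSpace E]
    {ν : Measure E} (hm : Tendsto m l atTop) {V : ∀ n, Fin (m n) → Ω → E}
    (hVm : ∀ n i, Measurable (V n i)) (hV : ∀ n i, HasLaw (V n i) ν μ)
    (hind : ∀ n, iIndepFun (V n) μ) {B : Set E} (hB : MeasurableSet B) :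
    TendstoInMeasure μ (fun n ω => (∑ i, (V n i ⁻¹' B).indicator (1 : Ω → ℝ) ω) / m n) l
      fun _ => ν.real B := by
  have hf : Measurable (B.indicator (1 : E → ℝ)) := measurable_one.indicator hB
  have hmem : ∀ n i ω, (B.indicator (1 : E → ℝ) ∘ V n i) ω ∈ Set.Icc (0 : ℝ) 1 := fun n i ω =>
    ⟨Set.indicator_nonneg (fun _ _ => zero_le_one) _, Set.indicator_le_self' (by simp) _⟩
  have hcomp : ∀ n i, Measurable (B.indicator (1 : E → ℝ) ∘ V n i) := fun n i => hf.comp (hVm n i)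
  refine tendstoInMeasure_average hm
    (fun n i => memLp_of_bounded (.of_forall (hmem n i)) (hcomp n i).aestronglyMeasurable 2)
    (fun n i j hij => ((hind n).indepFun hij).comp hf hf) (fun n i => ?_)
    fun n i => variance_le_sq_of_bounded (.of_forall (hmem n i)) (hcomp n i).aemeasurable
  rw [(hV n i).integral_comp hf.aestronglyMeasurable, integral_indicator_one hB]

end Averages

section LimitsOfExpectations

variable {ι Ω : Type*} [MeasurableSpace Ω] {μ : Measure Ω} {l : Filter ι} {Z : ι → Ω → ℝ} {c : ℝ}

lemma le_sq_div_add_self (b : ℝ≥0∞) {M : ℝ≥0∞} (hM₀ : M ≠ 0) (hM : M ≠ ∞) :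
    b ≤ b ^ 2 / M + M := by
  rcases le_total b M with h | h
  · exact h.trans le_add_self
  · refine le_trans ?_ le_self_add
    rw [ENNReal.le_div_iff_mul_le (.inl hM₀) (.inl hM), sq]
    gcongr

lemma lintegral_enorm_sub_le [IsProbabilityMeasure μ] {Z : Ω → ℝ} {A B : Ω → ℝ≥0∞}
    (hZm : Measurable Z) (hAm : Measurable A) (hBm : Measurable B)
    (hZAB : ∀ ω, ‖Z ω‖ₑ ≤ A ω + B ω) {M : ℝ≥0∞} (hM₀ : M ≠ 0) (hM : M ≠ ∞) (ε : ℝ≥0∞) :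
    ∫⁻ ω, ‖Z ω - c‖ₑ ∂μ ≤ ε + (∫⁻ ω, A ω ∂μ +
      ((∫⁻ ω, B ω ^ 2 ∂μ) / M + (M + ‖c‖ₑ) * μ {ω | ε ≤ edist (Z ω) c})) := by
  set D : Set Ω := {ω | ε ≤ edist (Z ω) c}
  have hDm : MeasurableSet D := measurableSet_le measurable_const (hZm.edist measurable_const)
  have hpointwise : ∀ ω, ‖Z ω - c‖ₑ ≤
      ε + (A ω + (B ω ^ 2 / M + D.indicator (fun _ => M + ‖c‖ₑ) ω)) := by
    intro ω
    by_cases hω : ω ∈ D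
    · have hBM := le_sq_div_add_self (B ω) hM₀ hM
      calc ‖Z ω - c‖ₑ ≤ ‖Z ω‖ₑ + ‖c‖ₑ := enorm_sub_le
        _ ≤ A ω + (B ω ^ 2 / M + M) + ‖c‖ₑ := by grw [hZAB ω, hBM]
        _ = A ω + (B ω ^ 2 / M + D.indicator (fun _ => M + ‖c‖ₑ) ω) := by
            rw [Set.indicator_of_mem hω]; ring
        _ ≤ _ := le_add_self
    · rw [← edist_eq_enorm_sub]
      exact (not_le.1 hω).le.trans le_self_add
  calc ∫⁻ ω, ‖Z ω - c‖ₑ ∂μ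
      ≤ ∫⁻ ω, ε + (A ω + (B ω ^ 2 / M + D.indicator (fun _ => M + ‖c‖ₑ) ω)) ∂μ :=
        lintegral_mono hpointwise
    _ = ε + (∫⁻ ω, A ω ∂μ + ((∫⁻ ω, B ω ^ 2 ∂μ) / M + (M + ‖c‖ₑ) * μ D)) := by
        simp only [div_eq_mul_inv]
        rw [lintegral_add_left measurable_const, lintegral_add_left hAm,
          lintegral_add_left ((hBm.pow_const 2).mul_const _),
          lintegral_mul_const _ (hBm.pow_const 2), lintegral_indicator_const hDm,
          lintegral_const, measure_univ, mul_one]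

/-- `A` is the part that is small in `L¹`, `B` the part that is uniformly integrable because it is
bounded in `L²`. -/
lemma tendsto_lintegral_enorm_sub [IsProbabilityMeasure μ] {A B : ι → Ω → ℝ≥0∞}
    (hZ : TendstoInMeasure μ Z l fun _ => c) (hZm : ∀ n, Measurable (Z n))
    (hAm : ∀ n, Measurable (A n)) (hBm : ∀ n, Measurable (B n))
    (hZAB : ∀ᶠ n in l, ∀ ω, ‖Z n ω‖ₑ ≤ A n ω + B n ω)
    (hA : Tendsto (fun n => ∫⁻ ω, A n ω ∂μ) l (𝓝 0)) {K : ℝ≥0∞} (hK : K ≠ ∞)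
    (hB : ∀ᶠ n in l, ∫⁻ ω, B n ω ^ 2 ∂μ ≤ K) :
    Tendsto (fun n => ∫⁻ ω, ‖Z n ω - c‖ₑ ∂μ) l (𝓝 0) := by
  rw [ENNReal.tendsto_nhds_zero]
  intro δ hδ
  set ε : ℝ≥0∞ := δ / 4
  have hε : 0 < ε := ENNReal.div_pos hδ.ne' (by simp)
  obtain ⟨M, hM, hKM⟩ : ∃ M : ℕ, 0 < M ∧ K / M < ε := by
    have hlim := ENNReal.Tendsto.const_div ENNReal.tendsto_nat_nhds_top (a := K)
      (.inr hK)
    rw [ENNReal.div_top] at hlim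
    exact ((eventually_gt_atTop 0).and (hlim.eventually_lt_const hε)).exists
  have hfar : Tendsto (fun n => (M + ‖c‖ₑ) * μ {ω | ε ≤ edist (Z n ω) c}) l (𝓝 0) := by
    simpa using ENNReal.Tendsto.const_mul (hZ ε hε) (.inr (by finiteness))
  filter_upwards [hZAB, hA.eventually_lt_const hε, hB, hfar.eventually_lt_const hε]
    with n hZn hAn hBn hfarn
  calc ∫⁻ ω, ‖Z n ω - c‖ₑ ∂μ
      ≤ _ := lintegral_enorm_sub_le (hZm n) (hAm n) (hBm n) hZn (by positivity)
        (ENNReal.natCast_ne_top M) ε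
    _ ≤ ε + (ε + (K / M + ε)) := by gcongr
    _ ≤ ε + (ε + (ε + ε)) := by gcongr
    _ = 4 * ε := by ring
    _ = δ := ENNReal.mul_div_cancel (by simp) (by simp)

lemma tendsto_lintegral_enorm_sub_of_le [IsProbabilityMeasure μ] {K : ℝ≥0∞} (hK : K ≠ ∞)
    (hZ : TendstoInMeasure μ Z l fun _ => c) (hZm : ∀ n, Measurable (Z n))
    (hZK : ∀ᶠ n in l, ∀ ω, ‖Z n ω‖ₑ ≤ K) :
    Tendsto (fun n => ∫⁻ ω, ‖Z n ω - c‖ₑ ∂μ) l (𝓝 0) := by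
  refine tendsto_lintegral_enorm_sub (A := fun _ _ => 0) (B := fun _ _ => K) hZ hZm
    (fun _ => measurable_const) (fun _ => measurable_const) (by simpa using hZK)
    (by simpa using tendsto_const_nhds)
    (K := K ^ 2) (by finiteness) (by simp)

lemma eventually_integrable_and_tendsto_integral [IsProbabilityMeasure μ]
    (hZm : ∀ n, Measurable (Z n)) (hZ : Tendsto (fun n => ∫⁻ ω, ‖Z n ω - c‖ₑ ∂μ) l (𝓝 0)) :
    (∀ᶠ n in l, Integrable (Z n) μ) ∧ Tendsto (fun n => ∫ ω, Z n ω ∂μ) l (𝓝 c) := by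
  have hZint : ∀ᶠ n in l, Integrable (Z n) μ := by
    filter_upwards [hZ.eventually_lt_const ENNReal.zero_lt_top] with n hn
    have hsub : Integrable (fun ω => Z n ω - c) μ :=
      ⟨((hZm n).sub_const c).aestronglyMeasurable, hn⟩
    exact (hsub.add (integrable_const c)).congr (.of_forall fun ω => sub_add_cancel _ _)
  refine ⟨hZint, ?_⟩
  simpa using tendsto_integral_of_L1 (fun _ => c) aestronglyMeasurable_const hZint hZ

end LimitsOfExpectations

section ConditionalProbability

lemma tendsto_real_cond_of_tendsto_one {ι Ω : Type*} [MeasurableSpace Ω] {μ : Measure Ω}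
    [IsProbabilityMeasure μ] {l : Filter ι} {A E : ι → Set Ω} {a : ℝ}
    (hEm : ∀ n, MeasurableSet (E n)) (hE : Tendsto (fun n => μ.real (E n)) l (𝓝 1))
    (hA : Tendsto (fun n => μ.real (A n)) l (𝓝 a)) :
    Tendsto (fun n => (μ[|E n]).real (A n)) l (𝓝 a) := by
  have hcompl : Tendsto (fun n => μ.real (E n)ᶜ) l (𝓝 0) := by
    simpa [probReal_compl_eq_one_sub (hEm _)] using hE.const_sub 1
  have hinter : Tendsto (fun n => μ.real (E n ∩ A n)) l (𝓝 a) := by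
    refine tendsto_of_tendsto_of_tendsto_of_le_of_le (by simpa using hA.sub hcompl) hA
      (fun n => ?_) fun n => measureReal_mono Set.inter_subset_right
    have hcover : A n ⊆ E n ∩ A n ∪ (E n)ᶜ := fun ω hω => by
      by_cases h : ω ∈ E n <;> simp [h, hω]
    linarith [(measureReal_mono hcover).trans (measureReal_union_le (μ := μ) _ _)]
  have hquot := (hE.inv₀ one_ne_zero).mul hinter
  rw [inv_one, one_mul] at hquot
  refine hquot.congr fun n => ?_
  rw [measureReal_def μ[|E n], cond_apply (hEm n), ENNReal.toReal_mul, ENNReal.toReal_inv,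
    measureReal_def, measureReal_def]

/-- Here `A` is compared with an event `B` that is independent of the conditioning. -/
lemma integral_abs_condExp_sub_le {Ω : Type*} {m m' m₀ : MeasurableSpace Ω} {μ : Measure[m₀] Ω}
    [IsProbabilityMeasure μ] (hm : m ≤ m₀) (hm' : m' ≤ m₀) {A B : Set Ω}
    (hA : MeasurableSet[m₀] A) (hB : MeasurableSet[m'] B) (hind : Indep m' m μ) :
    ∫ ω, |(μ⟦A | m⟧) ω - μ.real B| ∂μ ≤ μ.real (symmDiff A B) := by
  have hB₀ : MeasurableSet[m₀] B := hm' B hB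
  have hA_int : Integrable (A.indicator fun _ => (1 : ℝ)) μ := (integrable_const 1).indicator hA
  have hB_int : Integrable (B.indicator fun _ => (1 : ℝ)) μ := (integrable_const 1).indicator hB₀
  have hcondB : μ⟦B | m⟧ =ᵐ[μ] fun _ => μ.real B := by
    have h := condExp_indep_eq hm' hm ((stronglyMeasurable_const (b := (1 : ℝ))).indicator hB) hind
    rwa [integral_indicator_const _ hB₀, smul_eq_mul, mul_one] at h
  have hdiff : (fun ω => |(μ⟦A | m⟧) ω - μ.real B|) =ᵐ[μ]
      fun ω => |(μ[A.indicator (fun _ => (1 : ℝ)) - B.indicator (fun _ => (1 : ℝ)) | m]) ω| := by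
    filter_upwards [hcondB, condExp_sub hA_int hB_int m] with ω hBω hsub
    rw [hsub, Pi.sub_apply, hBω]
  have habs : ∀ ω, |(A.indicator (fun _ => (1 : ℝ)) - B.indicator (fun _ => (1 : ℝ))) ω|
      = (symmDiff A B).indicator (fun _ => (1 : ℝ)) ω := fun ω => by
    rw [Pi.sub_apply, ← Set.apply_indicator_symmDiff abs_neg,
      abs_of_nonneg (Set.indicator_nonneg (fun _ _ => zero_le_one) _)]
  calc ∫ ω, |(μ⟦A | m⟧) ω - μ.real B| ∂μ
      ≤ ∫ ω, |(A.indicator (fun _ => (1 : ℝ)) - B.indicator (fun _ => (1 : ℝ))) ω| ∂μ := by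
        rw [integral_congr_ae hdiff]
        exact integral_abs_condExp_le _
    _ = μ.real (symmDiff A B) := by
        simp only [habs]
        rw [integral_indicator_const _ (hA.symmDiff hB₀), smul_eq_mul, mul_one]

end ConditionalProbability

section Quantiles

variable {ν : Measure ℝ} {u : ℝ}

lemma exists_cdf_eq (hF : Continuous (cdf ν)) (hu : u ∈ Set.Ioo (0 : ℝ) 1) :
    ∃ q, cdf ν q = u := by
  refine mem_range_of_exists_le_of_exists_ge hF ?_ ?_
  · exact ((tendsto_cdf_atBot ν).eventually_le_const hu.1).exists
  · exact ((tendsto_cdf_atTop ν).eventually_const_le hu.2).exists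

lemma exists_cdf_mem_Ioo (hF : Continuous (cdf ν)) {x y : ℝ} (hx : 0 ≤ x) (hxy : x < y)
    (hy : y ≤ 1) : ∃ q, cdf ν q ∈ Set.Ioo x y := by
  obtain ⟨z, hxz, hzy⟩ := exists_between hxy
  obtain ⟨q, rfl⟩ := exists_cdf_eq hF ⟨hx.trans_lt hxz, hzy.trans_le hy⟩
  exact ⟨q, hxz, hzy⟩

lemma continuous_cdf_iff [IsProbabilityMeasure ν] :
    Continuous (cdf ν) ↔ ∀ x, ν {x} = 0 := by
  have hatom : ∀ x, ν {x} = 0 ↔ Function.leftLim (cdf ν) x = cdf ν x := fun x => by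
    conv_lhs => rw [← measure_cdf ν]
    rw [StieltjesFunction.measure_singleton, ENNReal.ofReal_eq_zero, sub_nonpos]
    exact ⟨fun h => ((monotone_cdf ν).leftLim_le le_rfl).antisymm h, fun h => h.ge⟩
  simp only [hatom, ← (monotone_cdf ν).continuousWithinAt_Iio_iff_leftLim_eq]
  refine ⟨fun h x => h.continuousWithinAt, fun h => continuous_iff_continuousAt.2 fun x => ?_⟩
  exact continuousAt_iff_continuous_left'_right'.2
    ⟨h x, ((cdf ν).right_continuous x).mono Set.Ioi_subset_Ici_self⟩

lemma measure_abs_cdf_sub_lt_le [IsProbabilityMeasure ν] (hF : Continuous (cdf ν)) {δ : ℝ}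
    (hδ : 0 < δ) (hδu : δ < u) (huδ : u + δ < 1) :
    ν {x | |cdf ν x - u| < δ} ≤ ENNReal.ofReal (2 * δ) := by
  obtain ⟨a, ha⟩ := exists_cdf_eq hF (u := u - δ) ⟨by linarith, by linarith⟩
  obtain ⟨b, hb⟩ := exists_cdf_eq hF (u := u + δ) ⟨by linarith, huδ⟩
  have hsub : {x | |cdf ν x - u| < δ} ⊆ Set.Ioc a b := fun x hx => by
    obtain ⟨hlower, hupper⟩ := abs_lt.1 (show |cdf ν x - u| < δ from hx)
    exact ⟨(monotone_cdf ν).reflect_lt (by linarith),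
      ((monotone_cdf ν).reflect_lt (show cdf ν x < cdf ν b by linarith)).le⟩
  calc ν {x | |cdf ν x - u| < δ} ≤ (cdf ν).measure (Set.Ioc a b) := by
        rw [measure_cdf]; exact measure_mono hsub
    _ = ENNReal.ofReal (2 * δ) := by rw [StieltjesFunction.measure_Ioc, ha, hb]; ring_nf

variable {ι Ω : Type*} [MeasurableSpace Ω] {μ : Measure Ω} {l : Filter ι}
  {S V Q : ι → Ω → ℝ} {q : ℝ}

lemma exists_measure_abs_cdf_sub_lt_le [IsProbabilityMeasure ν] (hF : Continuous (cdf ν))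
    (hu : u ∈ Set.Ioo (0 : ℝ) 1) {ε : ℝ≥0∞} (hε : 0 < ε) :
    ∃ δ > 0, ν {x | |cdf ν x - u| < δ} ≤ ε := by
  have hlim : Tendsto (fun δ : ℝ => ENNReal.ofReal (2 * δ)) (𝓝[>] 0) (𝓝 0) :=
    ((ENNReal.continuous_ofReal.comp (continuous_const_mul 2)).tendsto' 0 0 (by simp)).mono_left
      nhdsWithin_le_nhds
  obtain ⟨δ, hδε, hδ, hδmin⟩ := ((hlim.eventually_le_const hε).and
    (Ioo_mem_nhdsGT (lt_min hu.1 (sub_pos.2 hu.2)))).exists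
  rw [lt_min_iff] at hδmin
  exact ⟨δ, hδ, (measure_abs_cdf_sub_lt_le hF hδ hδmin.1 (by linarith [hδmin.2])).trans hδε⟩

lemma tendstoInMeasure_of_tendstoInMeasure_cdf (hq : ∃! t, cdf ν t = u) (hqu : cdf ν q = u)
    (hQ : TendstoInMeasure μ (fun n ω => cdf ν (Q n ω)) l fun _ => u) :
    TendstoInMeasure μ Q l fun _ => q := by
  rw [tendstoInMeasure_iff_norm]
  intro ε hε
  have hne : ∀ t, t ≠ q → cdf ν t ≠ u := fun t ht htu => ht (hq.unique htu hqu)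
  have hlower : cdf ν (q - ε) < u :=
    lt_of_le_of_ne (hqu ▸ monotone_cdf ν (by linarith)) (hne _ (by linarith))
  have hupper : u < cdf ν (q + ε) :=
    lt_of_le_of_ne (hqu ▸ monotone_cdf ν (by linarith)) (hne _ (by linarith)).symm
  refine tendsto_measure_zero_mono (tendsto_measure_zero_union
    (tendsto_measure_setOf_le_of_lt hQ tendsto_const_nhds hupper)
    (tendsto_measure_setOf_ge_of_lt hQ tendsto_const_nhds hlower)) (.of_forall fun n ω hω => ?_)
  rcases le_abs'.1 (show ε ≤ |Q n ω - q| from hω) with h | h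
  · exact .inr (monotone_cdf ν (by linarith))
  · exact .inl (monotone_cdf ν (by linarith))

lemma abs_sub_le_of_not_iff {F : ℝ → ℝ} (hF : Monotone F) {s t v q : ℝ}
    (h : ¬(s ≤ t ↔ v ≤ q)) : |F v - F q| ≤ |F s - F v| + |F t - F q| := by
  have hsv := abs_le.1 (le_refl |F s - F v|)
  have htq := abs_le.1 (le_refl |F t - F q|)
  rcases le_or_gt s t with hst | hts <;> rcases le_or_gt v q with hvq | hqv
  · exact absurd (iff_of_true hst hvq) h
  · rw [abs_of_nonneg (sub_nonneg.2 (hF hqv.le))]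
    linarith [hF hst]
  · rw [abs_of_nonpos (sub_nonpos.2 (hF hvq))]
    linarith [hF hts.le]
  · exact absurd (iff_of_false hts.not_ge hqv.not_ge) h

lemma tendsto_measure_symmDiff_of_tendstoInMeasure_cdf [IsProbabilityMeasure μ]
    [l.IsCountablyGenerated] [IsProbabilityMeasure ν] (hF : Continuous (cdf ν))
    (hu : u ∈ Set.Ioo (0 : ℝ) 1) (hV : ∀ n, HasLaw (V n) ν μ)
    (hSVm : ∀ n, Measurable fun ω => S n ω - V n ω)
    (hSV : TendstoInMeasure μ (fun n ω => S n ω - V n ω) l fun _ => 0)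
    (hQ : TendstoInMeasure μ (fun n ω => cdf ν (Q n ω)) l fun _ => u) (hq : cdf ν q = u) :
    Tendsto (fun n => μ (symmDiff {ω | S n ω ≤ Q n ω} {ω | V n ω ≤ q})) l (𝓝 0) := by
  have hcdf : TendstoInMeasure μ (fun n ω => cdf ν (V n ω + (S n ω - V n ω)) - cdf ν (V n ω)) l
      fun _ => 0 :=
    tendstoInMeasure_zero_of_hasLaw (G := fun x => cdf ν (x.1 + x.2) - cdf ν x.1) (by fun_prop)
      (by simp) hV hSV hSVm
  simp only [add_sub_cancel] at hcdf
  rw [ENNReal.tendsto_nhds_zero]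
  intro ε hε
  obtain ⟨δ, hδ, hδε⟩ := exists_measure_abs_cdf_sub_lt_le hF hu (ENNReal.half_pos hε.ne')
  rw [tendstoInMeasure_iff_norm] at hcdf hQ
  have hrest := tendsto_measure_zero_union (hcdf (δ / 3) (by linarith)) (hQ (δ / 3) (by linarith))
  filter_upwards [hrest.eventually_lt_const (ENNReal.half_pos hε.ne')] with n hn
  have hcover : symmDiff {ω | S n ω ≤ Q n ω} {ω | V n ω ≤ q} ⊆
      V n ⁻¹' {x | |cdf ν x - u| < δ} ∪ ({ω | δ / 3 ≤ ‖cdf ν (S n ω) - cdf ν (V n ω) - 0‖} ∪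
        {ω | δ / 3 ≤ ‖cdf ν (Q n ω) - u‖}) := fun ω hω => by
    have hle := abs_sub_le_of_not_iff (monotone_cdf ν) fun h => (Set.mem_symmDiff.1 hω).elim
      (fun hω => hω.2 (h.1 hω.1)) fun hω => hω.2 (h.2 hω.1)
    rw [hq] at hle
    by_contra hfar
    simp only [Set.mem_union, Set.mem_preimage, Set.mem_ofPred_eq, not_or, not_le, not_lt,
      sub_zero, Real.norm_eq_abs] at hfar
    linarith [hfar.1, hfar.2.1, hfar.2.2]
  calc μ (symmDiff {ω | S n ω ≤ Q n ω} {ω | V n ω ≤ q}) ≤ _ := measure_mono hcover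
    _ ≤ _ := measure_union_le _ _
    _ ≤ ε / 2 + ε / 2 := by
        gcongr
        have hVδ := (hV n).measure_eq (p := fun x => |cdf ν x - u| < δ)
          (measurableSet_lt (by fun_prop) measurable_const)
        exact hVδ.le.trans hδε
    _ = ε := ENNReal.add_halves ε

end Quantiles

section AbsoluteValues

variable {ν : Measure ℝ} [IsProbabilityMeasure ν] {c : ℝ}

lemma continuous_cdf_map_const_mul_abs (hF : Continuous (cdf ν)) (hc : c ≠ 0) :
    Continuous (cdf (ν.map fun e => c * |e|)) := by
  have : IsProbabilityMeasure (ν.map fun e => c * |e|) :=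
    Measure.isProbabilityMeasure_map (by fun_prop)
  rw [continuous_cdf_iff] at hF ⊢
  intro x
  rw [Measure.map_apply (by fun_prop) (measurableSet_singleton x)]
  refine measure_mono_null (t := {x / c} ∪ {-(x / c)}) (fun e he => ?_)
    (measure_union_null (hF _) (hF _))
  exact eq_or_eq_neg_of_abs_eq ((eq_div_iff hc).2 ((mul_comm _ _).trans he))

lemma cdf_map_const_mul_abs (hc : 0 < c) (t : ℝ) :
    cdf (ν.map fun e => c * |e|) t = cdf (ν.map fun e => |e|) (t / c) := by
  have hprob (a : ℝ) : IsProbabilityMeasure (ν.map fun e => a * |e|) :=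
    Measure.isProbabilityMeasure_map (by fun_prop)
  have : IsProbabilityMeasure (ν.map fun e => |e|) :=
    Measure.isProbabilityMeasure_map (by fun_prop)
  rw [cdf_eq_real, cdf_eq_real, map_measureReal_apply (by fun_prop) measurableSet_Iic,
    map_measureReal_apply (by fun_prop) measurableSet_Iic]
  congr 1 with e
  simp [le_div_iff₀' hc]

lemma pos_of_cdf_map_abs_pos (hF : Continuous (cdf ν)) {q : ℝ}
    (hq : 0 < cdf (ν.map fun e => |e|) q) : 0 < q := by
  have : IsProbabilityMeasure (ν.map fun e => |e|) :=
    Measure.isProbabilityMeasure_map (by fun_prop)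
  by_contra! hq0
  rw [cdf_eq_real, map_measureReal_apply (by fun_prop) measurableSet_Iic] at hq
  have hsub : (fun e : ℝ => |e|) ⁻¹' Set.Iic q ⊆ {0} := fun e he =>
    abs_nonpos_iff.1 (le_trans he hq0)
  simp [Measure.real, measure_mono_null hsub (continuous_cdf_iff.1 hF 0)] at hq

end AbsoluteValues

section EmpiricalQuantiles

variable {ι Ω : Type*} [MeasurableSpace Ω] {μ : Measure Ω} {l : Filter ι} {m k : ι → ℕ} {u : ℝ}
  {ν : Measure ℝ}

lemma sum_indicator_eq_card {α β : Type*} {m : ℕ} (s : Fin m → α → β) (B : Set β)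
    [DecidablePred (· ∈ B)] (x : α) :
    ∑ i, (s i ⁻¹' B).indicator (1 : α → ℝ) x = (Finset.univ.filter fun i => s i x ∈ B).card := by
  classical simp [Set.indicator_apply]

lemma lintegral_enorm_indicator_sub_indicator {A B : Set Ω} (hA : MeasurableSet A)
    (hB : MeasurableSet B) :
    ∫⁻ ω, ‖A.indicator (1 : Ω → ℝ) ω - B.indicator 1 ω‖ₑ ∂μ = μ (symmDiff A B) := by
  rw [← lintegral_indicator_one (hA.symmDiff hB)]
  congr with ω
  rw [← Set.apply_indicator_symmDiff enorm_neg, enorm_indicator_eq_indicator_enorm]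
  simp only [Pi.one_apply, enorm_one]
  rfl

lemma tendstoInMeasure_frequency_le {S V : ∀ n, Fin (m n) → Ω → ℝ} {S₀ V₀ : ι → Ω → ℝ}
    [IsProbabilityMeasure μ] [l.IsCountablyGenerated] [IsProbabilityMeasure ν]
    (hF : Continuous (cdf ν)) (hm : Tendsto m l atTop)
    (hSm : ∀ n i, Measurable (S n i)) (hVm : ∀ n i, Measurable (V n i))
    (hV : ∀ n i, HasLaw (V n i) ν μ) (hVind : ∀ n, iIndepFun (V n) μ)
    (hSV : ∀ n i, IdentDistrib (fun ω => (S n i ω, V n i ω)) (fun ω => (S₀ n ω, V₀ n ω)) μ μ)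
    (hSV₀ : TendstoInMeasure μ (fun n ω => S₀ n ω - V₀ n ω) l fun _ => 0)
    (hSVm₀ : ∀ n, Measurable fun ω => S₀ n ω - V₀ n ω) (hV₀ : ∀ n, HasLaw (V₀ n) ν μ) {a : ℝ}
    (ha : cdf ν a ∈ Set.Ioo (0 : ℝ) 1) :
    TendstoInMeasure μ
      (fun n ω => ((Finset.univ.filter fun i => S n i ω ≤ a).card : ℝ) / m n) l
      fun _ => cdf ν a := by
  have hfreqV := tendstoInMeasure_frequency hm hVm hV hVind (measurableSet_Iic (a := a))
  have hsymm := tendsto_measure_symmDiff_of_tendstoInMeasure_cdf hF ha hV₀ hSVm₀ hSV₀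
    (Q := fun _ _ => a) (q := a) (fun ε hε => by simpa [hε.ne'] using tendsto_const_nhds) rfl
  have hpair : ∀ n i, μ (symmDiff (S n i ⁻¹' Set.Iic a) (V n i ⁻¹' Set.Iic a)) =
      μ (symmDiff {ω | S₀ n ω ≤ a} {ω | V₀ n ω ≤ a}) := fun n i =>
    (hSV n i).measure_mem_eq (s := symmDiff {x | x.1 ≤ a} {x | x.2 ≤ a})
      ((measurableSet_le measurable_fst measurable_const).symmDiff
        (measurableSet_le measurable_snd measurable_const))
  have hdiff : TendstoInMeasure μ
      (fun n ω => (∑ i, ((S n i ⁻¹' Set.Iic a).indicator (1 : Ω → ℝ) ω -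
        (V n i ⁻¹' Set.Iic a).indicator 1 ω)) / m n) l fun _ => 0 := by
    refine tendstoInMeasure_average_zero
      (fun n i => (measurable_one.indicator (hSm n i measurableSet_Iic)).sub
        (measurable_one.indicator (hVm n i measurableSet_Iic))) (fun n i => ?_) hsymm
    rw [lintegral_enorm_indicator_sub_indicator (hSm n i measurableSet_Iic)
      (hVm n i measurableSet_Iic), hpair]
  have hsum := tendstoInMeasure_comp_of_continuousAt (G := fun x : ℝ × ℝ => x.1 + x.2)
    (by fun_prop) (tendstoInMeasure_prodMk hdiff hfreqV)
  simpa only [Finset.sum_sub_distrib, sub_div, sub_add_cancel, zero_add, sum_indicator_eq_card,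
    Set.mem_Iic, ← cdf_eq_real] using hsum

lemma tendstoInMeasure_cdf_kthSmallest [IsProbabilityMeasure ν] {S : ∀ n, Fin (m n) → Ω → ℝ}
    (hF : Continuous (cdf ν))
    (hfreq : ∀ a, cdf ν a ∈ Set.Ioo (0 : ℝ) 1 → TendstoInMeasure μ
      (fun n ω => ((Finset.univ.filter fun i => S n i ω ≤ a).card : ℝ) / m n) l
      fun _ => cdf ν a)
    (hu : u ∈ Set.Ioo (0 : ℝ) 1) (hk : Tendsto (fun n => (k n : ℝ) / m n) l (𝓝 u)) :
    TendstoInMeasure μ (fun n ω => cdf ν (kthSmallest (k n) fun i => S n i ω)) l fun _ => u := by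
  rw [tendstoInMeasure_iff_norm]
  intro ε hε
  obtain ⟨a, hεa, hau⟩ := exists_cdf_mem_Ioo hF (le_max_left 0 (u - ε))
    (max_lt hu.1 (by linarith)) hu.2.le
  obtain ⟨b, hub, hbε⟩ := exists_cdf_mem_Ioo hF hu.1.le
    (lt_min hu.2 (show u < u + ε by linarith)) (min_le_left 1 _)
  rw [max_lt_iff] at hεa
  rw [lt_min_iff] at hbε
  refine tendsto_measure_zero_mono (tendsto_measure_zero_union
    (tendsto_measure_setOf_le_of_lt (hfreq a ⟨hεa.1, hau.trans hu.2⟩) hk hau)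
    (tendsto_measure_setOf_ge_of_lt (hfreq b ⟨hu.1.trans hub, hbε.1⟩) hk hub)) ?_
  filter_upwards [hk.eventually_const_lt hu.1, hk.eventually_lt_const hu.2] with n hpos hlt ω hω
  have hm : (0 : ℝ) < m n := Nat.cast_pos.2 <| Nat.pos_of_ne_zero fun h => by simp [h] at hpos
  have hk1 : 1 ≤ k n := Nat.one_le_iff_ne_zero.2 fun h => by simp [h] at hpos
  have hkm : k n ≤ m n := by exact_mod_cast ((div_lt_one hm).1 hlt).le
  by_contra hQ
  simp only [Set.mem_union, Set.mem_ofPred_eq, div_le_div_iff_of_pos_right hm, Nat.cast_le,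
    not_or, ← kthSmallest_le_iff hk1 hkm] at hQ
  have hbQ := monotone_cdf ν ((kthSmallest_le_iff hk1 hkm).2 (not_le.1 hQ.2).le)
  have haQ := monotone_cdf ν (not_le.1 hQ.1).le
  exact (show |_ - u| < ε from abs_lt.2 ⟨by linarith, by linarith⟩).not_ge hω

end EmpiricalQuantiles

section Exchangeability

variable {Ω E F : Type*} [MeasurableSpace Ω] [MeasurableSpace E] [MeasurableSpace F]
  {μ : Measure Ω} {X : ℕ → Ω → E} {Z : ℕ → Ω → F}

lemma Exchangeable.identDistrib (hX : Exchangeable μ X) (hXm : ∀ i, Measurable (X i))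
    (τ : Equiv.Perm ℕ) : IdentDistrib (fun ω i => X (τ i) ω) (fun ω i => X i ω) μ μ :=
  ⟨(measurable_pi_lambda _ fun i => hXm (τ i)).aemeasurable,
    (measurable_pi_lambda _ hXm).aemeasurable, hX τ⟩

lemma exchangeable_of_iIndepFun [IsProbabilityMeasure μ] (hXm : ∀ i, Measurable (X i))
    (hind : iIndepFun X μ) (hid : ∀ i, IdentDistrib (X i) (X 0) μ μ) : Exchangeable μ X := by
  intro τ
  rw [(iIndepFun_iff_map_fun_eq_infinitePi_map hXm).1 hind,
    (iIndepFun_iff_map_fun_eq_infinitePi_map fun i => hXm (τ i)).1 (hind.precomp τ.injective)]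
  simp only [(hid _).map_eq]

lemma Exchangeable.prodMk [IsProbabilityMeasure μ] (hX : Exchangeable μ X)
    (hZ : Exchangeable μ Z) (hXm : ∀ i, Measurable (X i)) (hZm : ∀ i, Measurable (Z i))
    (hind : IndepFun (fun ω i => X i ω) (fun ω i => Z i ω) μ) :
    Exchangeable μ fun i ω => (X i ω, Z i ω) := by
  have hpair (τ : Equiv.Perm ℕ) : μ.map (fun ω => (fun i => X (τ i) ω, fun i => Z (τ i) ω))
      = (μ.map fun ω i => X i ω).prod (μ.map fun ω i => Z i ω) := by
    rw [← hX τ, ← hZ τ]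
    refine (indepFun_iff_map_prod_eq_prod_map_map (by fun_prop) (by fun_prop)).1 ?_
    exact hind.comp (φ := fun x i => x (τ i)) (ψ := fun z i => z (τ i)) (by fun_prop) (by fun_prop)
  have hzip (τ : Equiv.Perm ℕ) : μ.map (fun ω i => (X (τ i) ω, Z (τ i) ω))
      = (μ.map fun ω => (fun i => X (τ i) ω, fun i => Z (τ i) ω)).map fun w i =>
        (w.1 i, w.2 i) := by
    rw [Measure.map_map (by fun_prop) (by fun_prop)]
    rfl
  intro τ
  exact (hzip τ).trans ((hpair τ).trans (hpair 1).symm ▸ (hzip 1).symm)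

lemma Exchangeable.identDistrib_prodMk (hX : Exchangeable μ X) (hXm : ∀ i, Measurable (X i))
    {m i j : ℕ} (hi : m ≤ i) (hj : m ≤ j) :
    IdentDistrib (fun ω => (fun k : Fin m => X k ω, X i ω))
      (fun ω => (fun k : Fin m => X k ω, X j ω)) μ μ := by
  have h := (hX.identDistrib hXm (Equiv.swap i j)).comp
    (u := fun x : ℕ → E => (fun k : Fin m => x k, x j)) (by fun_prop)
  refine (IdentDistrib.of_ae_eq (by fun_prop) (.of_forall fun ω => ?_)).trans h
  have hswap (k : Fin m) : Equiv.swap i j k = k :=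
    Equiv.swap_apply_of_ne_of_ne (by omega) (by omega)
  simp [hswap]

end Exchangeability

section FreshLeverage

variable {Ω : Type*} [MeasurableSpace Ω] {μ : Measure Ω} {p : ℕ}
  {X : ℕ → Ω → EuclideanSpace ℝ (Fin p)}

lemma Exchangeable.lintegral_leverage_eq (hX : Exchangeable μ X) (hXm : ∀ i, Measurable (X i))
    {m : ℕ} (i j : Fin m) :
    ∫⁻ ω, ENNReal.ofReal (leverage (fun k : Fin m => X k ω) (X i ω)) ∂μ
      = ∫⁻ ω, ENNReal.ofReal (leverage (fun k : Fin m => X k ω) (X j ω)) ∂μ := by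
  have hmeas : Measurable fun x : ℕ → EuclideanSpace ℝ (Fin p) =>
      ENNReal.ofReal (leverage (fun k : Fin m => x k) (x j)) :=
    (measurable_leverage.comp (by fun_prop : Measurable fun x : ℕ → EuclideanSpace ℝ (Fin p) =>
      (fun k : Fin m => x k, x j))).ennreal_ofReal
  have h := ((hX.identDistrib hXm (Equiv.swap (i : ℕ) j)).comp hmeas).lintegral_eq
  refine (lintegral_congr fun ω => ?_).trans h
  have hswap : (fun k : Fin m => X (Equiv.swap (i : ℕ) j k) ω)
      = fun k => X (Equiv.swap i j k : Fin m) ω := by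
    funext k
    simp only [Equiv.swap_apply_def, Fin.ext_iff]
    split_ifs <;> rfl
  simp only [Function.comp_def, hswap, Equiv.swap_apply_right]
  rw [leverage_comp_perm (fun k : Fin m => X k ω)]

lemma Exchangeable.mul_lintegral_leverage_le [IsProbabilityMeasure μ] (hX : Exchangeable μ X)
    (hXm : ∀ i, Measurable (X i)) {m : ℕ} (i : Fin m) :
    m * ∫⁻ ω, ENNReal.ofReal (leverage (fun k : Fin m => X k ω) (X i ω)) ∂μ ≤ p := by
  have hmeas (j : Fin m) :
      Measurable fun ω => ENNReal.ofReal (leverage (fun k : Fin m => X k ω) (X j ω)) :=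
    (measurable_leverage.comp (by fun_prop : Measurable fun ω =>
      (fun k : Fin m => X k ω, X j ω))).ennreal_ofReal
  calc m * ∫⁻ ω, ENNReal.ofReal (leverage (fun k : Fin m => X k ω) (X i ω)) ∂μ
      = ∑ j : Fin m, ∫⁻ ω, ENNReal.ofReal (leverage (fun k : Fin m => X k ω) (X j ω)) ∂μ := by
        simp [hX.lintegral_leverage_eq hXm _ i]
    _ = ∫⁻ ω, ENNReal.ofReal (∑ j : Fin m, leverage (fun k : Fin m => X k ω) (X j ω)) ∂μ := by
        rw [← lintegral_finsetSum _ fun j _ => hmeas j]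
        simp only [ENNReal.ofReal_sum_of_nonneg fun _ _ => leverage_nonneg _ _]
    _ ≤ ∫⁻ _, ENNReal.ofReal p ∂μ :=
        lintegral_mono fun ω => ENNReal.ofReal_le_ofReal (sum_leverage_le _)
    _ = p := by simp

lemma Exchangeable.tendstoInMeasure_leverage_last [IsProbabilityMeasure μ]
    (hX : Exchangeable μ X) (hXm : ∀ i, Measurable (X i)) {ι : Type*} {l : Filter ι} {m : ι → ℕ}
    (hm : Tendsto m l atTop) :
    TendstoInMeasure μ (fun n ω => leverage (fun k : Fin (m n + 1) => X k ω) (X (m n) ω)) l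
      fun _ => 0 := by
  refine tendstoInMeasure_of_tendsto_eLpNorm one_ne_zero (fun n => ?_)
    aestronglyMeasurable_const ?_
  · exact (measurable_leverage.comp (by fun_prop : Measurable fun ω =>
      (fun k : Fin (m n + 1) => X k ω, X (m n) ω))).aestronglyMeasurable
  have hlim : Tendsto (fun n => (p : ℝ≥0∞) / (m n + 1 : ℕ)) l (𝓝 0) := by
    have h := ENNReal.Tendsto.const_div (a := (p : ℝ≥0∞))
      (ENNReal.tendsto_nat_nhds_top.comp ((tendsto_add_atTop_nat 1).comp hm)) (.inr (by simp))
    rwa [ENNReal.div_top] at h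
  refine tendsto_of_tendsto_of_tendsto_of_le_of_le tendsto_const_nhds hlim
    (fun _ => zero_le) fun n => ?_
  have hle := hX.mul_lintegral_leverage_le hXm (Fin.last (m n))
  simp only [eLpNorm_one_eq_lintegral_enorm, Pi.sub_apply, sub_zero,
    Real.enorm_of_nonneg (leverage_nonneg _ _)]
  rw [ENNReal.le_div_iff_mul_le (by simp) (by simp), mul_comm]
  exact hle

lemma Exchangeable.tendstoInMeasure_leverage [IsProbabilityMeasure μ] (hX : Exchangeable μ X)
    (hXm : ∀ i, Measurable (X i)) {ι : Type*} {l : Filter ι} {m t : ι → ℕ}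
    (hm : Tendsto m l atTop) (ht : ∀ n, m n ≤ t n)
    (hinv : Tendsto (fun n => μ {ω | ¬ IsUnit (gram fun k : Fin (m n) => X k ω)}) l (𝓝 0)) :
    TendstoInMeasure μ (fun n ω => leverage (fun k : Fin (m n) => X k ω) (X (t n) ω)) l
      fun _ => 0 := by
  have hlast := tendstoInMeasure_iff_norm.1 (hX.tendstoInMeasure_leverage_last hXm hm)
  rw [tendstoInMeasure_iff_norm]
  intro ε hε
  have hnext : Tendsto (fun n => μ {ω | ε ≤ leverage (fun k : Fin (m n) => X k ω) (X (m n) ω)}) l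
      (𝓝 0) := by
    refine tendsto_measure_zero_mono (tendsto_measure_zero_union hinv
      (hlast (ε / (1 + ε)) (by positivity))) (.of_forall fun n ω hω => ?_)
    by_cases hunit : IsUnit (gram fun k : Fin (m n) => X k ω)
    · refine .inr ?_
      have hmorrison := leverage_last_mul_one_add (fun k : Fin (m n + 1) => X k ω) hunit
      simp only [Fin.val_last, Fin.val_castSucc] at hmorrison
      have hpos : 0 < 1 + leverage (fun k : Fin (m n) => X k ω) (X (m n) ω) := by
        linarith [leverage_nonneg (fun k : Fin (m n) => X k ω) (X (m n) ω)]
      rw [← eq_div_iff hpos.ne'] at hmorrison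
      have hω : ε ≤ leverage (fun k : Fin (m n) => X k ω) (X (m n) ω) := hω
      simp only [Set.mem_ofPred_eq, hmorrison, sub_zero]
      refine le_trans ?_ (le_abs_self _)
      rw [div_le_div_iff₀ (by positivity) hpos]
      linarith
    · exact .inl hunit
  refine hnext.congr fun n => ?_
  have hmeas : MeasurableSet {w : (Fin (m n) → EuclideanSpace ℝ (Fin p)) ×
      EuclideanSpace ℝ (Fin p) | ε ≤ leverage w.1 w.2} :=
    measurableSet_le measurable_const measurable_leverage
  simpa [abs_of_nonneg (leverage_nonneg _ _)] using
    (hX.identDistrib_prodMk hXm le_rfl (ht n)).measure_mem_eq hmeas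

end FreshLeverage

section Weights

lemma continuous_comp_max {φ : ℝ → ℝ} (hφ : ContinuousOn φ (Set.Ici 0)) :
    Continuous fun t => φ (max 0 t) :=
  hφ.comp_continuous (by fun_prop) fun t => le_max_left 0 t

lemma measurable_comp_leverage {p m : ℕ} {φ : ℝ → ℝ} (hφ : ContinuousOn φ (Set.Ici 0)) :
    Measurable fun v : (Fin m → EuclideanSpace ℝ (Fin p)) × EuclideanSpace ℝ (Fin p) =>
      φ (leverage v.1 v.2) := by
  simpa only [Function.comp_def, max_eq_right (leverage_nonneg _ _)] using
    (continuous_comp_max hφ).measurable.comp measurable_leverage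

/-- Weights for leverage-weighted scores. Only the values on `[0, ∞)` matter, since leverages are
nonnegative. -/
structure IsWeight (w : ℝ → ℝ) : Prop where
  continuousOn : ContinuousOn w (Set.Ici 0)
  pos : ∀ t, 0 ≤ t → 0 < w t

end Weights

lemma IsBigOInProbability.tendstoInMeasure_zero {Ω : Type*} [MeasurableSpace Ω] {μ : Measure Ω}
    {Z : ℕ → Ω → ℝ} {a : ℕ → ℝ} (hZ : IsBigOInProbability μ Z a) (ha : Tendsto a atTop (𝓝 0)) :
    TendstoInMeasure μ Z atTop fun _ => 0 := by
  rw [tendstoInMeasure_iff_norm]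
  intro ε hε
  rw [ENNReal.tendsto_nhds_zero]
  intro δ hδ
  obtain ⟨M, hM⟩ := hZ δ hδ
  have hMa : Tendsto (fun n => M * a n) atTop (𝓝 0) := by simpa using ha.const_mul M
  filter_upwards [hM, hMa.eventually_lt_const hε] with n hn hlt
  refine (measure_mono fun ω hω => ?_).trans hn
  exact hlt.trans_le (by simpa using hω)

namespace Setup

variable {Ω : Type*} {p : ℕ} {S : Setup Ω p}

lemma h_nonneg (n : ℕ) (ω : Ω) (x : EuclideanSpace ℝ (Fin p)) : 0 ≤ S.h n ω x :=
  leverage_nonneg _ _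

lemma htest_nonneg (n : ℕ) (ω : Ω) : 0 ≤ S.htest n ω :=
  h_nonneg n ω _

variable (S) in
/-- The estimate of `βstar` as a function of the features and the noise of the training points. -/
def estimate (n : ℕ) (d : Fin (S.n₁ n) → EuclideanSpace ℝ (Fin p) × ℝ) :
    EuclideanSpace ℝ (Fin p) :=
  S.fit n fun i => ((d i).1, inner ℝ (d i).1 S.βstar
    + S.σ * √(S.g (leverage (fun k => (d k).1) (d i).1)) * (d i).2)

variable (S) in
/-- Prediction error of the signal, `xᵀ (β̂ - β*)`. -/
def signalError (n : ℕ) (ω : Ω) (x : EuclideanSpace ℝ (Fin p)) : ℝ :=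
  inner ℝ x (S.βhat n ω - S.βstar)

variable (S) in
/-- Leverage, signal error and noise of the point with index `j`: its score depends on the sample
only through this triple. -/
def pointData (n j : ℕ) (ω : Ω) : ℝ × ℝ × ℝ :=
  (S.h n ω (S.X j ω), S.signalError n ω (S.X j ω), S.η j ω)

variable (S) in
/-- The score as a function of leverage, signal error and noise. The truncation `max 0` makes it
continuous although `g` and `w` are only controlled on `[0, ∞)`. -/
def pointScore (w : ℝ → ℝ) (v : ℝ × ℝ × ℝ) : ℝ :=
  |S.σ * √(S.g (max 0 v.1)) * v.2.2 - v.2.1| * w (max 0 v.1)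

variable (S) in
/-- The factor `c` such that the score of a fresh point is asymptotically `c * |η|`. -/
def scoreScale (w : ℝ → ℝ) : ℝ := S.σ * √(S.g 0) * w 0

lemma score_response_eq (w : ℝ → ℝ) (n : ℕ) (ω : Ω) (x : EuclideanSpace ℝ (Fin p)) (e : ℝ) :
    S.score w n ω x (S.response n ω x e)
      = S.pointScore w (S.h n ω x, S.signalError n ω x, e) := by
  simp only [score, response, fhat, pointScore, signalError, inner_sub_right,
    max_eq_right (h_nonneg n ω x)]
  congr 2
  ring

lemma score_eq_pointScore (w : ℝ → ℝ) (n j : ℕ) (ω : Ω) :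
    S.score w n ω (S.X j ω) (S.Y n j ω) = S.pointScore w (S.pointData n j ω) :=
  score_response_eq w n ω _ _

lemma qhat_eq_kthSmallest (w : ℝ → ℝ) (α : ℝ) (n : ℕ) (ω : Ω) :
    S.qhat w α n ω = kthSmallest (conformalRank α (S.n₂ n))
      fun i : Fin (S.n₂ n) => S.pointScore w (S.pointData n (S.n₁ n + i) ω) := by
  simp only [qhat, score_eq_pointScore, conformalRank]

lemma mem_interval_iff {w : ℝ → ℝ} {α : ℝ} {n : ℕ} {ω : Ω} {x : EuclideanSpace ℝ (Fin p)}
    (hw : 0 < w (S.h n ω x)) (y : ℝ) :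
    y ∈ S.interval w α n ω x ↔ S.score w n ω x y ≤ S.qhat w α n ω := by
  rw [interval, score, Set.mem_Icc, ← le_div_iff₀ hw, abs_le]
  constructor <;> rintro ⟨hlower, hupper⟩ <;> constructor <;> linarith

lemma covered_eq {w : ℝ → ℝ} (hw : IsWeight w) (α : ℝ) (n : ℕ) :
    S.covered w α n =
      {ω | S.pointScore w (S.pointData n (S.testIdx n) ω) ≤ S.qhat w α n ω} := by
  ext ω
  exact (mem_interval_iff (hw.pos _ (h_nonneg n ω _)) _).trans
    (iff_of_eq (congrArg (· ≤ _) (score_eq_pointScore w n _ ω)))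

variable [MeasurableSpace Ω] {μ : Measure Ω}

namespace ScaleFamilyModel

section Scores

variable {w : ℝ → ℝ}

lemma g_pos (hS : S.ScaleFamilyModel μ) {t : ℝ} (ht : 0 ≤ t) : 0 < S.g t :=
  hS.g_zero.trans_le (hS.g_mono.monotoneOn Set.self_mem_Ici ht ht)

lemma isWeight_wstar (hS : S.ScaleFamilyModel μ) : IsWeight S.wstar where
  continuousOn := continuousOn_const.div hS.g_cont.sqrt fun _ ht =>
    (Real.sqrt_pos.2 (hS.g_pos ht)).ne'
  pos _ ht := one_div_pos.2 (Real.sqrt_pos.2 (hS.g_pos ht))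

lemma scoreScale_pos (hS : S.ScaleFamilyModel μ) (hw : IsWeight w) : 0 < S.scoreScale w :=
  mul_pos (mul_pos hS.σ_pos (Real.sqrt_pos.2 hS.g_zero)) (hw.pos 0 le_rfl)

lemma continuous_pointScore (hS : S.ScaleFamilyModel μ) (hw : IsWeight w) :
    Continuous (S.pointScore w) := by
  have hg := (continuous_comp_max hS.g_cont).comp (continuous_fst (X := ℝ) (Y := ℝ × ℝ))
  have hw := (continuous_comp_max hw.continuousOn).comp (continuous_fst (X := ℝ) (Y := ℝ × ℝ))
  exact (((continuous_const.mul hg.sqrt).mul continuous_snd.snd).sub continuous_snd.fst).abs.mul hw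

lemma pointScore_zero (hS : S.ScaleFamilyModel μ) (e : ℝ) :
    S.pointScore w (0, 0, e) = S.scoreScale w * |e| := by
  have hscale : 0 ≤ S.σ * √(S.g 0) := mul_nonneg hS.σ_pos.le (Real.sqrt_nonneg _)
  simp only [pointScore, scoreScale, max_self, sub_zero, abs_mul (S.σ * √(S.g 0)),
    abs_of_nonneg hscale]
  ring

end Scores

section Measurability

variable {w : ℝ → ℝ}

lemma measurable_estimate (hS : S.ScaleFamilyModel μ) (n : ℕ) : Measurable (S.estimate n) := by
  have hg (i : Fin (S.n₁ n)) := (measurable_comp_leverage hS.g_cont).comp (by fun_prop :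
    Measurable fun d : Fin (S.n₁ n) → EuclideanSpace ℝ (Fin p) × ℝ =>
      (fun k => (d k).1, (d i).1))
  refine (hS.measurable_fit n).comp (measurable_pi_lambda _ fun i => ?_)
  have := hg i
  fun_prop

lemma measurable_pointData_of_sample (hS : S.ScaleFamilyModel μ) (n : ℕ) :
    Measurable fun v : (Fin (S.n₁ n) → EuclideanSpace ℝ (Fin p) × ℝ) ×
        EuclideanSpace ℝ (Fin p) × ℝ =>
      (leverage (fun k => (v.1 k).1) v.2.1,
        inner ℝ v.2.1 (S.estimate n v.1 - S.βstar), v.2.2) := by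
  have hestimate := hS.measurable_estimate n
  have hleverage := measurable_leverage.comp (by fun_prop : Measurable fun
    v : (Fin (S.n₁ n) → EuclideanSpace ℝ (Fin p) × ℝ) × EuclideanSpace ℝ (Fin p) × ℝ =>
      (fun k => (v.1 k).1, v.2.1))
  exact hleverage.prodMk (by fun_prop)

lemma measurable_pointData (hS : S.ScaleFamilyModel μ) (n j : ℕ) :
    Measurable (S.pointData n j) := by
  have hX := hS.measurable_X
  have hη := hS.measurable_η
  exact (hS.measurable_pointData_of_sample n).comp (by fun_prop : Measurable fun ω =>
    (fun k : Fin (S.n₁ n) => (S.X k ω, S.η k ω), S.X j ω, S.η j ω))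

lemma identDistrib_pointData [IsProbabilityMeasure μ] (hS : S.ScaleFamilyModel μ) {n i j : ℕ}
    (hi : S.n₁ n ≤ i) (hj : S.n₁ n ≤ j) :
    IdentDistrib (S.pointData n i) (S.pointData n j) μ μ := by
  have hexch := hS.exchangeable_X.prodMk
    (exchangeable_of_iIndepFun hS.measurable_η hS.indep_η hS.ident_η)
    hS.measurable_X hS.measurable_η hS.indep_X_η
  exact (hexch.identDistrib_prodMk (fun k => (hS.measurable_X k).prodMk (hS.measurable_η k))
    hi hj).comp (hS.measurable_pointData_of_sample n)

lemma measurable_pointScore (hS : S.ScaleFamilyModel μ) (hw : IsWeight w) (n j : ℕ) :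
    Measurable fun ω => S.pointScore w (S.pointData n j ω) :=
  (hS.continuous_pointScore hw).measurable.comp (hS.measurable_pointData n j)

lemma measurable_qhat (hS : S.ScaleFamilyModel μ) (hw : IsWeight w) (α : ℝ) (n : ℕ) :
    Measurable (S.qhat w α n) := by
  simp only [funext (qhat_eq_kthSmallest (S := S) w α n)]
  exact measurable_kthSmallest.comp
    (measurable_pi_lambda _ fun _ => hS.measurable_pointScore hw n _)

lemma measurable_htest (hS : S.ScaleFamilyModel μ) (n : ℕ) : Measurable (S.htest n) :=
  (hS.measurable_pointData n (S.testIdx n)).fst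

lemma measurableSet_covered (hS : S.ScaleFamilyModel μ) (hw : IsWeight w) (α : ℝ) (n : ℕ) :
    MeasurableSet (S.covered w α n) := by
  rw [covered_eq hw]
  exact measurableSet_le (hS.measurable_pointScore hw n _) (hS.measurable_qhat hw α n)

end Measurability

end ScaleFamilyModel

end Setup

namespace Setup

variable {Ω : Type*} {p : ℕ} {S : Setup Ω p} [MeasurableSpace Ω] {μ : Measure Ω} {w : ℝ → ℝ}
  {α : ℝ}

variable (S) (μ) (w) in
/-- Limit law of the score of a fresh point. -/
def scoreLaw : Measure ℝ := (μ.map (S.η 0)).map fun e => S.scoreScale w * |e|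

lemma Regular.tendstoInMeasure_estimator {Fh : Measure ℝ} (hreg : S.Regular μ Fh) :
    TendstoInMeasure μ (fun n ω => S.βhat n ω - S.βstar) atTop fun _ => 0 := by
  have hrate : Tendsto (fun n => 1 / √(S.n₁ n : ℝ)) atTop (𝓝 0) :=
    tendsto_const_nhds.div_atTop
      (Real.tendsto_sqrt_atTop.comp (tendsto_natCast_atTop_atTop.comp hreg.n₁_tendsto))
  have hnorm := hreg.consistent.tendstoInMeasure_zero hrate
  rw [tendstoInMeasure_iff_norm] at hnorm ⊢
  simpa using hnorm

namespace ScaleFamilyModel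

lemma hasLaw_noise (hS : S.ScaleFamilyModel μ) (j : ℕ) : HasLaw (S.η j) (μ.map (S.η 0)) μ :=
  ⟨(hS.measurable_η j).aemeasurable, (hS.ident_η j).map_eq⟩

lemma hasLaw_scoreLaw (hS : S.ScaleFamilyModel μ) (j : ℕ) :
    HasLaw (fun ω => S.scoreScale w * |S.η j ω|) (S.scoreLaw μ w) μ :=
  HasLaw.comp (Y := fun e => S.scoreScale w * |e|) ⟨by fun_prop, rfl⟩ (hS.hasLaw_noise j)

lemma measurable_score_sub (hS : S.ScaleFamilyModel μ) (hw : IsWeight w) (n j : ℕ) :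
    Measurable fun ω => S.pointScore w (S.pointData n j ω) - S.scoreScale w * |S.η j ω| := by
  have hη := hS.measurable_η j
  have hscore := hS.measurable_pointScore hw n j
  fun_prop

lemma measurable_βhat (hS : S.ScaleFamilyModel μ) (n : ℕ) : Measurable (S.βhat n) := by
  have hX := hS.measurable_X
  have hη := hS.measurable_η
  exact (hS.measurable_estimate n).comp (by fun_prop : Measurable fun ω =>
    fun k : Fin (S.n₁ n) => (S.X k ω, S.η k ω))

variable [IsProbabilityMeasure μ] {Fh : Measure ℝ}

section LimitsOfScores

lemma isProbabilityMeasure_noise (hS : S.ScaleFamilyModel μ) :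
    IsProbabilityMeasure (μ.map (S.η 0)) :=
  Measure.isProbabilityMeasure_map (hS.measurable_η 0).aemeasurable

lemma isProbabilityMeasure_scoreLaw (hS : S.ScaleFamilyModel μ) :
    IsProbabilityMeasure (S.scoreLaw μ w) :=
  have := hS.isProbabilityMeasure_noise
  Measure.isProbabilityMeasure_map (by fun_prop)

lemma continuous_cdf_scoreLaw (hS : S.ScaleFamilyModel μ) (hreg : S.Regular μ Fh)
    (hw : IsWeight w) : Continuous (cdf (S.scoreLaw μ w)) :=
  have := hS.isProbabilityMeasure_noise
  continuous_cdf_map_const_mul_abs hreg.cdf_cont (hS.scoreScale_pos hw).ne'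

lemma tendstoInMeasure_htest (hS : S.ScaleFamilyModel μ) (hreg : S.Regular μ Fh) :
    TendstoInMeasure μ S.htest atTop fun _ => 0 :=
  hS.exchangeable_X.tendstoInMeasure_leverage hS.measurable_X hreg.n₁_tendsto
    (fun _ => Nat.le_add_right _ _) hS.gram_invertible

lemma tendstoInMeasure_signalError (hS : S.ScaleFamilyModel μ) (hreg : S.Regular μ Fh) :
    TendstoInMeasure μ (fun n ω => S.signalError n ω (S.Xtest n ω)) atTop fun _ => 0 := by
  have hlaw (n : ℕ) : HasLaw (S.Xtest n) (μ.map (S.X 0)) μ :=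
    ⟨(hS.measurable_X _).aemeasurable, ((hS.exchangeable_X.identDistrib_prodMk hS.measurable_X
      (Nat.zero_le (S.testIdx n)) le_rfl).comp measurable_snd).map_eq⟩
  exact tendstoInMeasure_zero_of_hasLaw
    (G := fun v : EuclideanSpace ℝ (Fin p) × EuclideanSpace ℝ (Fin p) => inner ℝ v.1 v.2)
    (by fun_prop) (fun _ => inner_zero_right _) hlaw hreg.tendstoInMeasure_estimator
    fun n => (hS.measurable_βhat n).sub_const _

lemma tendstoInMeasure_score_sub (hS : S.ScaleFamilyModel μ) (hreg : S.Regular μ Fh)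
    (hw : IsWeight w) :
    TendstoInMeasure μ (fun n ω => S.pointScore w (S.pointData n (S.testIdx n) ω)
      - S.scoreScale w * |S.η (S.testIdx n) ω|) atTop fun _ => 0 := by
  have hscore := hS.continuous_pointScore hw
  exact tendstoInMeasure_zero_of_hasLaw
    (X := fun n => S.η (S.testIdx n))
    (Y := fun n ω => (S.htest n ω, S.signalError n ω (S.Xtest n ω))) (c := (0, 0))
    (G := fun v : ℝ × ℝ × ℝ => S.pointScore w (v.2.1, v.2.2, v.1) - S.scoreScale w * |v.1|)
    (by fun_prop) (fun e => sub_eq_zero.2 (hS.pointScore_zero e))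
    (fun n => hS.hasLaw_noise (S.testIdx n))
    (tendstoInMeasure_prodMk (hS.tendstoInMeasure_htest hreg)
      (hS.tendstoInMeasure_signalError hreg))
    fun n => (hS.measurable_htest n).prodMk (hS.measurable_pointData n (S.testIdx n)).snd.fst

lemma tendstoInMeasure_cdf_qhat (hS : S.ScaleFamilyModel μ) (hreg : S.Regular μ Fh)
    (hw : IsWeight w) (hα : α ∈ Set.Ioo (0 : ℝ) 1) :
    TendstoInMeasure μ (fun n ω => cdf (S.scoreLaw μ w) (S.qhat w α n ω)) atTop
      fun _ => 1 - α := by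
  have := hS.isProbabilityMeasure_scoreLaw (w := w)
  have hF := hS.continuous_cdf_scoreLaw hreg hw
  have hη := hS.measurable_η
  simp only [qhat_eq_kthSmallest]
  refine tendstoInMeasure_cdf_kthSmallest hF (fun a ha => ?_)
    ⟨sub_pos.2 hα.2, sub_lt_self 1 hα.1⟩
    ((tendsto_conformalRank_div hα.2.le).comp hreg.n₂_tendsto)
  refine tendstoInMeasure_frequency_le
    (V := fun n i ω => S.scoreScale w * |S.η (S.n₁ n + i) ω|) hF hreg.n₂_tendsto
    (fun n i => hS.measurable_pointScore hw n _) (fun n i => by fun_prop)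
    (fun n i => hS.hasLaw_scoreLaw _) (fun n => ?_) (fun n i => ?_)
    (hS.tendstoInMeasure_score_sub hreg hw) (fun n => hS.measurable_score_sub hw n _)
    (fun n => hS.hasLaw_scoreLaw _) ha
  · have hinj : Function.Injective fun i : Fin (S.n₂ n) => S.n₁ n + (i : ℕ) := fun i j hij =>
      Fin.ext (Nat.add_left_cancel hij)
    exact (hS.indep_η.precomp hinj).comp (fun _ e => S.scoreScale w * |e|) fun _ => by fun_prop
  · have hscore := (hS.continuous_pointScore hw).measurable
    exact (hS.identDistrib_pointData (Nat.le_add_right _ _) (Nat.le_add_right _ _)).comp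
      (u := fun v => (S.pointScore w v, S.scoreScale w * |v.2.2|)) (by fun_prop)

end LimitsOfScores

section Coverage

lemma exists_cdf_scoreLaw_eq (hS : S.ScaleFamilyModel μ) (hreg : S.Regular μ Fh)
    (hw : IsWeight w) (hα : α ∈ Set.Ioo (0 : ℝ) 1) : ∃ q, cdf (S.scoreLaw μ w) q = 1 - α :=
  exists_cdf_eq (hS.continuous_cdf_scoreLaw hreg hw) ⟨sub_pos.2 hα.2, sub_lt_self 1 hα.1⟩

lemma tendsto_measure_covered_symmDiff (hS : S.ScaleFamilyModel μ) (hreg : S.Regular μ Fh)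
    (hw : IsWeight w) (hα : α ∈ Set.Ioo (0 : ℝ) 1) {q : ℝ}
    (hq : cdf (S.scoreLaw μ w) q = 1 - α) :
    Tendsto (fun n => μ.real (symmDiff (S.covered w α n)
      {ω | S.scoreScale w * |S.η (S.testIdx n) ω| ≤ q})) atTop (𝓝 0) := by
  have := hS.isProbabilityMeasure_scoreLaw (w := w)
  have h := tendsto_measure_symmDiff_of_tendstoInMeasure_cdf
    (hS.continuous_cdf_scoreLaw hreg hw) ⟨sub_pos.2 hα.2, sub_lt_self 1 hα.1⟩
    (fun n => hS.hasLaw_scoreLaw (S.testIdx n)) (fun n => hS.measurable_score_sub hw n _)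
    (hS.tendstoInMeasure_score_sub hreg hw) (hS.tendstoInMeasure_cdf_qhat hreg hw hα) hq
  simp only [covered_eq hw]
  exact (ENNReal.tendsto_toReal_zero_iff fun _ => measure_ne_top _ _).2 h

lemma real_setOf_scoreScale_mul_abs_le (hS : S.ScaleFamilyModel μ) (j : ℕ) (q : ℝ) :
    μ.real {ω | S.scoreScale w * |S.η j ω| ≤ q} = cdf (S.scoreLaw μ w) q := by
  have := hS.isProbabilityMeasure_scoreLaw (w := w)
  rw [cdf_eq_real]
  exact (hS.hasLaw_scoreLaw j).measureReal_eq measurableSet_Iic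

theorem tendsto_condExp_covered (hS : S.ScaleFamilyModel μ) (hreg : S.Regular μ Fh)
    (hw : IsWeight w) (hα : α ∈ Set.Ioo (0 : ℝ) 1) :
    Tendsto (fun n => ∫ ω, |(μ⟦S.covered w α n | MeasurableSpace.comap (S.htest n) inferInstance⟧) ω
      - (1 - α)| ∂μ) atTop (𝓝 0) := by
  obtain ⟨q, hq⟩ := hS.exists_cdf_scoreLaw_eq hreg hw hα
  refine squeeze_zero (fun n => integral_nonneg fun ω => abs_nonneg _) (fun n => ?_)
    (hS.tendsto_measure_covered_symmDiff hreg hw hα hq)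
  have hindep : S.η (S.testIdx n) ⟂ᵢ[μ] S.htest n :=
    (hS.indep_X_η.comp
      (measurable_leverage.comp (by fun_prop : Measurable fun x : ℕ → EuclideanSpace ℝ (Fin p) =>
        (fun k : Fin (S.n₁ n) => x k, x (S.testIdx n))))
      (measurable_pi_apply (S.testIdx n))).symm
  rw [← hq, ← hS.real_setOf_scoreScale_mul_abs_le (S.testIdx n)]
  exact integral_abs_condExp_sub_le (hS.measurable_htest n).comap_le
    (hS.measurable_η _).comap_le (hS.measurableSet_covered hw α n)
    ⟨{e | S.scoreScale w * |e| ≤ q}, measurableSet_le (by fun_prop) (by fun_prop), rfl⟩ hindep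

lemma tendsto_real_covered (hS : S.ScaleFamilyModel μ) (hreg : S.Regular μ Fh)
    (hw : IsWeight w) (hα : α ∈ Set.Ioo (0 : ℝ) 1) :
    Tendsto (fun n => μ.real (S.covered w α n)) atTop (𝓝 (1 - α)) := by
  obtain ⟨q, hq⟩ := hS.exists_cdf_scoreLaw_eq hreg hw hα
  refine tendsto_iff_norm_sub_tendsto_zero.2 (squeeze_zero (fun n => norm_nonneg _) (fun n => ?_)
    (hS.tendsto_measure_covered_symmDiff hreg hw hα hq))
  rw [← hq, ← hS.real_setOf_scoreScale_mul_abs_le (S.testIdx n)]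
  have hη := hS.measurable_η (S.testIdx n)
  exact abs_measureReal_sub_le_measureReal_symmDiff
    (hS.measurableSet_covered hw α n).nullMeasurableSet
    (measurableSet_le (by fun_prop) (by fun_prop)).nullMeasurableSet

lemma tendsto_real_htest_near_zero (hS : S.ScaleFamilyModel μ) (hreg : S.Regular μ Fh) {r : ℝ}
    (hr : 0 < r) : Tendsto (fun n => μ.real {ω | |S.htest n ω - 0| < r}) atTop (𝓝 1) := by
  have hfar := tendstoInMeasure_iff_measureReal_norm.1 (hS.tendstoInMeasure_htest hreg) r hr
  refine (by simpa using hfar.const_sub 1 : Tendsto _ atTop (𝓝 (1 : ℝ))).congr fun n => ?_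
  have hh := hS.measurable_htest n
  rw [← probReal_compl_eq_one_sub (measurableSet_le (by fun_prop) (by fun_prop))]
  simp [Set.compl_ofPred]

theorem tendsto_cond_covered (hS : S.ScaleFamilyModel μ) (hreg : S.Regular μ Fh)
    (hw : IsWeight w) (hα : α ∈ Set.Ioo (0 : ℝ) 1) {r : ℝ} (hr : 0 < r) :
    (∀ᶠ n in atTop, 0 < μ {ω | |S.htest n ω - 0| < r}) ∧
      Tendsto (fun n => (μ[|{ω | |S.htest n ω - 0| < r}]).real (S.covered w α n))
        atTop (𝓝 (1 - α)) := by
  have hnear := hS.tendsto_real_htest_near_zero hreg hr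
  refine ⟨?_, tendsto_real_cond_of_tendsto_one (fun n => ?_) hnear
    (hS.tendsto_real_covered hreg hw hα)⟩
  · filter_upwards [hnear.eventually_const_lt one_pos] with n hn
    exact (ENNReal.toReal_pos_iff.1 hn).1
  · have hh := hS.measurable_htest n
    exact measurableSet_lt (by fun_prop) measurable_const

lemma coverageAt_eq_cdf (hS : S.ScaleFamilyModel μ) (hw : IsWeight w) {n : ℕ} {ω : Ω}
    (hinv : IsUnit (gram (S.design n ω))) {x : EuclideanSpace ℝ (Fin p)} (hx : S.h n ω x = 0) :
    S.coverageAt μ w α n ω x = cdf (S.scoreLaw μ w) (S.qhat w α n ω) := by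
  have := hS.isProbabilityMeasure_scoreLaw (w := w)
  have hx0 : x = 0 := eq_zero_of_leverage_eq_zero hinv hx
  have herror : S.signalError n ω x = 0 := by simp [signalError, hx0]
  have hwx : 0 < w (S.h n ω x) := hw.pos _ (h_nonneg n ω x)
  rw [cdf_eq_real, scoreLaw, map_measureReal_apply (by fun_prop) measurableSet_Iic, coverageAt]
  simp only [mem_interval_iff hwx, score_response_eq, hx, herror, hS.pointScore_zero]
  rfl

theorem tendsto_coverageAt (hS : S.ScaleFamilyModel μ) (hreg : S.Regular μ Fh)
    (hw : IsWeight w) (hα : α ∈ Set.Ioo (0 : ℝ) 1) {ε : ℝ} (hε : 0 < ε) :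
    Tendsto (fun n => μ {ω | ∃ x, S.h n ω x = 0 ∧ ε ≤ |S.coverageAt μ w α n ω x - (1 - α)|})
      atTop (𝓝 0) := by
  refine tendsto_measure_zero_mono (tendsto_measure_zero_union hS.gram_invertible
    (tendstoInMeasure_iff_norm.1 (hS.tendstoInMeasure_cdf_qhat hreg hw hα) ε hε))
    (.of_forall fun n ω ⟨x, hx, hfar⟩ => ?_)
  by_cases hinv : IsUnit (gram (S.design n ω))
  · rw [hS.coverageAt_eq_cdf hw hinv hx] at hfar
    exact .inr hfar
  · exact .inl hinv

lemma tendstoInMeasure_average_leverage (hS : S.ScaleFamilyModel μ) (hreg : S.Regular μ Fh)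
    (φ : ℝ →ᵇ ℝ) :
    TendstoInMeasure μ
      (fun n ω => (∑ i : Fin (S.n₂ n), φ (S.h n ω (S.X (S.n₁ n + i) ω))) / (S.n₂ n : ℝ))
      atTop fun _ => φ 0 := by
  have hh (n j : ℕ) := (hS.measurable_pointData n j).fst
  have hdist : TendstoInMeasure μ (fun n ω => φ (S.htest n ω)) atTop fun _ => φ 0 :=
    tendstoInMeasure_comp_of_continuousAt φ.continuous.continuousAt
      (hS.tendstoInMeasure_htest hreg)
  have hbound := tendsto_lintegral_enorm_sub_of_le (K := ENNReal.ofReal ‖φ‖) ENNReal.ofReal_ne_top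
    hdist (fun n => φ.continuous.measurable.comp (hS.measurable_htest n))
    (.of_forall fun n ω => by
      rw [← ofReal_norm]; exact ENNReal.ofReal_le_ofReal (φ.norm_coe_le_norm _))
  have haverage := tendstoInMeasure_average_zero (μ := μ) (m := S.n₂)
    (Z := fun n i ω => φ (S.h n ω (S.X (S.n₁ n + i) ω)) - φ 0)
    (fun n i => (φ.continuous.measurable.comp (hh n _)).sub_const _) (fun n i => ?_) hbound
  · have hshift := tendstoInMeasure_comp_of_continuousAt (G := fun t => t + φ 0)
      (by fun_prop) haverage
    rw [zero_add] at hshift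
    refine hshift.congr' ?_ .rfl
    filter_upwards [hreg.n₂_tendsto.eventually_gt_atTop 0] with n hn
    refine .of_forall fun ω => ?_
    have hn' : (S.n₂ n : ℝ) ≠ 0 := by positivity
    simp [sub_div, mul_div_cancel_left₀ _ hn']
  · exact ((hS.identDistrib_pointData (Nat.le_add_right _ _) (Nat.le_add_right _ _)).comp
      (u := fun v => ‖φ v.1 - φ 0‖ₑ)
      ((φ.continuous.measurable.comp measurable_fst).sub_const _).enorm).lintegral_eq.le

theorem eq_dirac_zero [IsProbabilityMeasure Fh] (hS : S.ScaleFamilyModel μ)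
    (hreg : S.Regular μ Fh) : Fh = Measure.dirac 0 := by
  refine ext_of_forall_integral_eq_of_IsFiniteMeasure fun φ => ?_
  rw [integral_dirac]
  obtain ⟨_, hlim⟩ := (tendstoInMeasure_ae_unique (hreg.leverage_weak φ)
    (hS.tendstoInMeasure_average_leverage hreg φ)).exists
  exact hlim

end Coverage

end ScaleFamilyModel

end Setup

namespace Setup

variable {Ω : Type*} {p : ℕ} {S : Setup Ω p} {w w' : ℝ → ℝ} {α : ℝ}

variable (S) in
/-- Weights lying between the constant weight and `wstar` in strength: they decrease with the
leverage, but not faster than `1 / √g`. -/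
structure IsIntermediateWeight (w : ℝ → ℝ) : Prop extends IsWeight w where
  antitoneOn : AntitoneOn w (Set.Ici 0)
  monotoneOn_sqrt_mul : MonotoneOn (fun t => √(S.g t) * w t) (Set.Ici 0)

lemma IsIntermediateWeight.sqrt_mul_le (hw : S.IsIntermediateWeight w) {a t : ℝ} (ha : 0 ≤ a)
    (ht : 0 ≤ t) (hga : 0 ≤ S.g a) (hgt : 0 ≤ S.g t) :
    √(S.g a) * w a ≤ √(S.g a + S.g t) * w t := by
  have hwt := (hw.pos t ht).le
  rcases le_total a t with hat | hta
  · calc √(S.g a) * w a ≤ √(S.g t) * w t := hw.monotoneOn_sqrt_mul ha ht hat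
      _ ≤ √(S.g a + S.g t) * w t := by gcongr; linarith
  · calc √(S.g a) * w a ≤ √(S.g a) * w t := by gcongr; exact hw.antitoneOn ht ha hta
      _ ≤ √(S.g a + S.g t) * w t := by gcongr; linarith

lemma IsIntermediateWeight.mul_sqrt_zero_le (hw : S.IsIntermediateWeight w) {a t : ℝ}
    (ha : 0 ≤ a) (ht : 0 ≤ t) : w a * √(S.g 0) ≤ √(S.g t) * w t :=
  calc w a * √(S.g 0) ≤ w 0 * √(S.g 0) := by gcongr; exact hw.antitoneOn Set.self_mem_Ici ha ha
    _ = √(S.g 0) * w 0 := mul_comm _ _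
    _ ≤ √(S.g t) * w t := hw.monotoneOn_sqrt_mul Set.self_mem_Ici ht ht

variable (S) in
/-- Bound, uniform over intermediate weights, for the contribution of the signal error at the
point with index `j` to the half-width of the interval at the test point. -/
def signalBound (n j : ℕ) (ω : Ω) : ℝ :=
  |S.signalError n ω (S.X j ω)| * (√(S.g (S.htest n ω)) / √(S.g 0))

variable (S) in
/-- Bound, uniform over intermediate weights, for the contribution of the noise of the point with
index `j` to the half-width of the interval at the test point. -/
def noiseBound (n j : ℕ) (ω : Ω) : ℝ :=
  S.σ * √(S.g (S.h n ω (S.X j ω)) + S.g (S.htest n ω)) * |S.η j ω|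

lemma pointScore_nonneg (hw : IsWeight w) (v : ℝ × ℝ × ℝ) : 0 ≤ S.pointScore w v :=
  mul_nonneg (abs_nonneg _) (hw.pos _ (le_max_left _ _)).le

lemma qhat_nonneg (hw : IsWeight w) (α : ℝ) (n : ℕ) (ω : Ω) : 0 ≤ S.qhat w α n ω := by
  rw [qhat_eq_kthSmallest]
  exact kthSmallest_nonneg fun i => pointScore_nonneg hw _

lemma width_nonneg (hw : IsWeight w) (α : ℝ) (n : ℕ) (ω : Ω) (x : EuclideanSpace ℝ (Fin p)) :
    0 ≤ S.width w α n ω x :=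
  div_nonneg (mul_nonneg zero_le_two (qhat_nonneg hw α n ω)) (hw.pos _ (h_nonneg n ω x)).le

variable [MeasurableSpace Ω] {μ : Measure Ω}

namespace ScaleFamilyModel

lemma isIntermediateWeight_one (hS : S.ScaleFamilyModel μ) :
    S.IsIntermediateWeight fun _ => 1 where
  continuousOn := continuousOn_const
  pos _ _ := one_pos
  antitoneOn := antitoneOn_const
  monotoneOn_sqrt_mul a ha t ht hat := by
    simpa using Real.sqrt_le_sqrt (hS.g_mono.monotoneOn ha ht hat)

lemma isIntermediateWeight_wstar (hS : S.ScaleFamilyModel μ) :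
    S.IsIntermediateWeight S.wstar where
  toIsWeight := hS.isWeight_wstar
  antitoneOn a ha t ht hat := one_div_le_one_div_of_le (Real.sqrt_pos.2 (hS.g_pos ha))
    (Real.sqrt_le_sqrt (hS.g_mono.monotoneOn ha ht hat))
  monotoneOn_sqrt_mul := by
    refine (monotoneOn_const (c := (1 : ℝ))).congr fun t ht => ?_
    exact (mul_one_div_cancel (Real.sqrt_pos.2 (hS.g_pos ht)).ne').symm

section WidthBound

lemma pointScore_div_le (hS : S.ScaleFamilyModel μ) (hw : S.IsIntermediateWeight w) (n j : ℕ)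
    (ω : Ω) : S.pointScore w (S.pointData n j ω) / w (S.htest n ω)
      ≤ S.signalBound n j ω + S.noiseBound n j ω := by
  have ha := h_nonneg (S := S) n ω (S.X j ω)
  have ht := htest_nonneg (S := S) n ω
  have hwt := hw.pos _ ht
  have hσ := hS.σ_pos
  have hg₀ := Real.sqrt_pos.2 hS.g_zero
  simp only [pointScore, pointData, signalBound, noiseBound, max_eq_right ha]
  set a := S.h n ω (S.X j ω)
  set t := S.htest n ω
  set e := S.signalError n ω (S.X j ω)
  have hsignal : w a / w t ≤ √(S.g t) / √(S.g 0) :=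
    (div_le_div_iff₀ hwt hg₀).2 (hw.mul_sqrt_zero_le ha ht)
  have hnoise : √(S.g a) * w a / w t ≤ √(S.g a + S.g t) :=
    (div_le_iff₀ hwt).2 (hw.sqrt_mul_le ha ht (hS.g_pos ha).le (hS.g_pos ht).le)
  have hwa := (hw.pos a ha).le
  calc |S.σ * √(S.g a) * S.η j ω - e| * w a / w t
      ≤ (|S.σ * √(S.g a) * S.η j ω| + |e|) * w a / w t := by gcongr; exact abs_sub _ _
    _ = |e| * (w a / w t) + S.σ * (√(S.g a) * w a / w t) * |S.η j ω| := by
        rw [abs_mul, abs_of_nonneg (mul_nonneg hσ.le (Real.sqrt_nonneg _))]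
        ring
    _ ≤ |e| * (√(S.g t) / √(S.g 0)) + S.σ * √(S.g a + S.g t) * |S.η j ω| := by gcongr

/-- A sample cannot have a large quantile without a large mean. -/
lemma eventually_width_le (hS : S.ScaleFamilyModel μ) (hn₂ : Tendsto S.n₂ atTop atTop)
    (hw : S.IsIntermediateWeight w) (hα : α ∈ Set.Ioo (0 : ℝ) 1) :
    ∀ᶠ n in atTop, ∀ ω, S.width w α n ω (S.Xtest n ω) ≤
      4 / α * ((∑ i : Fin (S.n₂ n), S.signalBound n (S.n₁ n + i) ω) / S.n₂ n)
        + 4 / α * ((∑ i : Fin (S.n₂ n), S.noiseBound n (S.n₁ n + i) ω) / S.n₂ n) := by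
  have hα₀ := hα.1
  filter_upwards [hn₂.eventually (eventually_half_mul_le_sub_conformalRank hα),
    hn₂.eventually_gt_atTop 0] with n hrank hpos ω
  have hm : (0 : ℝ) < S.n₂ n := by exact_mod_cast hpos
  have hwt : 0 < w (S.htest n ω) := hw.pos _ (htest_nonneg n ω)
  have hkm : conformalRank α (S.n₂ n) ≤ S.n₂ n := by
    have : (conformalRank α (S.n₂ n) : ℝ) ≤ S.n₂ n := by
      linarith [mul_pos (half_pos hα₀) hm]
    exact_mod_cast this
  have hmarkov : α / 2 * S.n₂ n * S.qhat w α n ω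
      ≤ ∑ i : Fin (S.n₂ n), S.pointScore w (S.pointData n (S.n₁ n + i) ω) := by
    refine (mul_le_mul_of_nonneg_right hrank (qhat_nonneg hw.toIsWeight α n ω)).trans ?_
    rw [qhat_eq_kthSmallest]
    exact sub_mul_kthSmallest_le_sum (fun i => pointScore_nonneg hw.toIsWeight _) hkm
  calc S.width w α n ω (S.Xtest n ω)
      = 4 / α * ((α / 2 * S.n₂ n * S.qhat w α n ω) / w (S.htest n ω) / S.n₂ n) := by
        rw [width, show S.h n ω (S.Xtest n ω) = S.htest n ω from rfl]
        field_simp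
        ring
    _ ≤ 4 / α * ((∑ i : Fin (S.n₂ n), S.pointScore w (S.pointData n (S.n₁ n + i) ω))
          / w (S.htest n ω) / S.n₂ n) := by gcongr
    _ ≤ 4 / α * ((∑ i : Fin (S.n₂ n), (S.signalBound n (S.n₁ n + i) ω
          + S.noiseBound n (S.n₁ n + i) ω)) / S.n₂ n) := by
        rw [Finset.sum_div]
        gcongr with i
        exact hS.pointScore_div_le hw n _ ω
    _ = _ := by rw [Finset.sum_add_distrib]; ring

end WidthBound

section Moments

lemma measurable_g_h (hS : S.ScaleFamilyModel μ) (n j : ℕ) :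
    Measurable fun ω => S.g (S.h n ω (S.X j ω)) := by
  have hX := hS.measurable_X
  exact (measurable_comp_leverage hS.g_cont).comp (by fun_prop : Measurable fun ω =>
    (fun k : Fin (S.n₁ n) => S.X k ω, S.X j ω))

lemma measurable_signalBound (hS : S.ScaleFamilyModel μ) (n j : ℕ) :
    Measurable (S.signalBound n j) := by
  have hg := hS.measurable_g_h n (S.testIdx n)
  have herror := (hS.measurable_pointData n j).snd.fst
  exact herror.abs.mul (hg.sqrt.div_const _)

lemma measurable_noiseBound (hS : S.ScaleFamilyModel μ) (n j : ℕ) :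
    Measurable (S.noiseBound n j) :=
  ((((hS.measurable_g_h n j).add (hS.measurable_g_h n (S.testIdx n))).sqrt).const_mul _).mul
    (hS.measurable_η j).abs

variable [IsProbabilityMeasure μ]

lemma lintegral_enorm_sq_noise (hS : S.ScaleFamilyModel μ) (j : ℕ) :
    ∫⁻ ω, ‖S.η j ω‖ₑ ^ 2 ∂μ = 1 := by
  have hvar := ofReal_variance hS.memLp_η
  rw [hS.var_η, ENNReal.ofReal_one, evariance, hS.mean_η] at hvar
  simp only [sub_zero] at hvar
  rw [hvar]
  exact ((hS.ident_η j).comp (u := fun e : ℝ => ‖e‖ₑ ^ 2) (by fun_prop)).lintegral_eq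

lemma lintegral_g_h_eq (hS : S.ScaleFamilyModel μ) {n j : ℕ} (hj : S.n₁ n ≤ j) :
    ∫⁻ ω, ENNReal.ofReal (S.g (S.h n ω (S.X j ω))) ∂μ
      = ∫⁻ ω, ENNReal.ofReal (S.g (S.htest n ω)) ∂μ := by
  have hg : Measurable fun v : ℝ × ℝ × ℝ => ENNReal.ofReal (S.g (max 0 v.1)) :=
    ((continuous_comp_max hS.g_cont).measurable.comp measurable_fst).ennreal_ofReal
  have h := ((hS.identDistrib_pointData hj (Nat.le_add_right _ (S.n₂ n))).comp hg).lintegral_eq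
  simp only [Function.comp_def, pointData, max_eq_right (h_nonneg n _ _)] at h
  exact h

lemma lintegral_signalError_sq_eq (hS : S.ScaleFamilyModel μ) {n j : ℕ} (hj : S.n₁ n ≤ j) :
    ∫⁻ ω, ‖S.signalError n ω (S.X j ω)‖ₑ ^ 2 ∂μ
      = ∫⁻ ω, ‖S.signalError n ω (S.Xtest n ω)‖ₑ ^ 2 ∂μ :=
  ((hS.identDistrib_pointData hj (Nat.le_add_right _ (S.n₂ n))).comp
    (u := fun v : ℝ × ℝ × ℝ => ‖v.2.1‖ₑ ^ 2) (by fun_prop)).lintegral_eq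

lemma lintegral_noiseBound_sq (hS : S.ScaleFamilyModel μ) {n j : ℕ} (hj : S.n₁ n ≤ j) :
    ∫⁻ ω, ‖S.noiseBound n j ω‖ₑ ^ 2 ∂μ
      = ‖S.σ‖ₑ ^ 2 * (2 * ∫⁻ ω, ENNReal.ofReal (S.g (S.htest n ω)) ∂μ) := by
  set G : Ω → ℝ≥0∞ := fun ω =>
    ENNReal.ofReal (S.g (S.h n ω (S.X j ω))) + ENNReal.ofReal (S.g (S.htest n ω)) with hG
  have hGm : Measurable G :=
    (hS.measurable_g_h n j).ennreal_ofReal.add (hS.measurable_g_h n (S.testIdx n)).ennreal_ofReal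
  have hindep : IndepFun G (fun ω => ‖S.η j ω‖ₑ ^ 2) μ := by
    have hg (i : ℕ) := ((measurable_comp_leverage (p := p) hS.g_cont).comp (by fun_prop :
      Measurable fun x : ℕ → EuclideanSpace ℝ (Fin p) =>
        (fun k : Fin (S.n₁ n) => x k, x i))).ennreal_ofReal
    exact hS.indep_X_η.comp ((hg j).add (hg (S.testIdx n)))
      (by fun_prop : Measurable fun e : ℕ → ℝ => ‖e j‖ₑ ^ 2)
  have hpointwise (ω : Ω) : ‖S.noiseBound n j ω‖ₑ ^ 2 = ‖S.σ‖ₑ ^ 2 * (G ω * ‖S.η j ω‖ₑ ^ 2) := by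
    have hgj := (hS.g_pos (h_nonneg (S := S) n ω (S.X j ω))).le
    have hgt := (hS.g_pos (htest_nonneg (S := S) n ω)).le
    rw [noiseBound, enorm_mul, enorm_mul, mul_pow, mul_pow, Real.enorm_abs,
      Real.enorm_of_nonneg (Real.sqrt_nonneg _), ← ENNReal.ofReal_pow (Real.sqrt_nonneg _),
      Real.sq_sqrt (add_nonneg hgj hgt), ENNReal.ofReal_add hgj hgt, mul_assoc]
  have hηm := (hS.measurable_η j).enorm.pow_const 2
  simp only [hpointwise]
  rw [lintegral_const_mul _ (by exact hGm.mul hηm),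
    lintegral_mul_eq_lintegral_mul_lintegral_of_indepFun'' hGm.aemeasurable
      hηm.aemeasurable hindep,
    hS.lintegral_enorm_sq_noise, mul_one, hG,
    lintegral_add_left (hS.measurable_g_h n j).ennreal_ofReal, hS.lintegral_g_h_eq hj, ← two_mul]

lemma lintegral_signalBound_le (hS : S.ScaleFamilyModel μ) {n j : ℕ} (hj : S.n₁ n ≤ j) :
    ∫⁻ ω, ‖S.signalBound n j ω‖ₑ ∂μ
      ≤ (∫⁻ ω, ‖S.signalError n ω (S.Xtest n ω)‖ₑ ^ 2 ∂μ) ^ (1 / 2 : ℝ)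
        * ((∫⁻ ω, ENNReal.ofReal (S.g (S.htest n ω)) ∂μ)
          / ENNReal.ofReal (S.g 0)) ^ (1 / 2 : ℝ) := by
  have hg := hS.measurable_g_h n (S.testIdx n)
  have herror := (hS.measurable_pointData n j).snd.fst
  have hsq (ω : Ω) : ‖√(S.g (S.htest n ω)) / √(S.g 0)‖ₑ ^ 2
      = ENNReal.ofReal (S.g (S.htest n ω)) / ENNReal.ofReal (S.g 0) := by
    rw [Real.enorm_of_nonneg (by positivity), ← ENNReal.ofReal_pow (by positivity), div_pow,
      Real.sq_sqrt (hS.g_pos (htest_nonneg n ω)).le, Real.sq_sqrt hS.g_zero.le,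
      ENNReal.ofReal_div_of_pos hS.g_zero]
  have hholder := ENNReal.lintegral_mul_le_Lp_mul_Lq μ Real.HolderConjugate.two_two
    herror.enorm.aemeasurable (hg.sqrt.div_const √(S.g 0)).enorm.aemeasurable
  simp only [ENNReal.rpow_two] at hholder
  calc ∫⁻ ω, ‖S.signalBound n j ω‖ₑ ∂μ
      = ∫⁻ ω, ‖S.signalError n ω (S.X j ω)‖ₑ * ‖√(S.g (S.htest n ω)) / √(S.g 0)‖ₑ ∂μ := by
        simp only [signalBound, enorm_mul, Real.enorm_abs]
    _ ≤ _ := hholder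
    _ = _ := by
        have hsq' : ∫⁻ ω, ‖√(S.g (S.htest n ω)) / √(S.g 0)‖ₑ ^ 2 ∂μ
            = (∫⁻ ω, ENNReal.ofReal (S.g (S.htest n ω)) ∂μ) / ENNReal.ofReal (S.g 0) := by
          simp only [hsq, ENNReal.div_eq_inv_mul]
          exact lintegral_const_mul _ hg.ennreal_ofReal
        rw [← hS.lintegral_signalError_sq_eq hj, ← hsq']
        rfl

lemma tendsto_lintegral_average_signalBound (hS : S.ScaleFamilyModel μ)
    (hwidth : S.WidthRegular μ α) :
    Tendsto (fun n => ∫⁻ ω, ‖(∑ i : Fin (S.n₂ n), S.signalBound n (S.n₁ n + i) ω) / S.n₂ n‖ₑ ∂μ)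
      atTop (𝓝 0) := by
  obtain ⟨B, hB⟩ := hwidth.noise_variance_bounded
  have herror : Tendsto (fun n => ∫⁻ ω, ‖S.signalError n ω (S.Xtest n ω)‖ₑ ^ 2 ∂μ) atTop (𝓝 0) := by
    refine hwidth.prediction_error.congr fun n => lintegral_congr fun ω => ?_
    rw [← Real.enorm_of_nonneg (sq_nonneg _), enorm_pow]
    rfl
  have hlim := ENNReal.Tendsto.mul_const (b := (ENNReal.ofReal B / ENNReal.ofReal (S.g 0))
    ^ (1 / 2 : ℝ)) (herror.ennrpow_const (1 / 2)) (.inr (by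
      have := ENNReal.ofReal_pos.2 hS.g_zero
      finiteness))
  rw [ENNReal.zero_rpow_of_pos (by norm_num), zero_mul] at hlim
  refine tendsto_of_tendsto_of_tendsto_of_le_of_le' tendsto_const_nhds hlim
    (.of_forall fun _ => zero_le) ?_
  filter_upwards [hB] with n hBn
  refine lintegral_enorm_average_le (fun i => hS.measurable_signalBound n _) fun i => ?_
  refine (hS.lintegral_signalBound_le (Nat.le_add_right _ _)).trans ?_
  gcongr

lemma eventually_lintegral_average_noiseBound_sq_le (hS : S.ScaleFamilyModel μ) {B : ℝ≥0∞}
    (hB : ∀ᶠ n in atTop, ∫⁻ ω, ENNReal.ofReal (S.g (S.htest n ω)) ∂μ ≤ B) :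
    ∀ᶠ n in atTop, ∫⁻ ω, ‖(∑ i : Fin (S.n₂ n), S.noiseBound n (S.n₁ n + i) ω) / S.n₂ n‖ₑ ^ 2 ∂μ
      ≤ ‖S.σ‖ₑ ^ 2 * (2 * B) := by
  filter_upwards [hB] with n hBn
  refine lintegral_enorm_average_sq_le (fun i => hS.measurable_noiseBound n _) fun i => ?_
  rw [hS.lintegral_noiseBound_sq (Nat.le_add_right _ _)]
  gcongr

end Moments

section WidthParity

lemma map_abs_noise (hS : S.ScaleFamilyModel μ) :
    (μ.map fun ω => |S.η 0 ω|) = (μ.map (S.η 0)).map fun e => |e| :=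
  (Measure.map_map (g := fun e : ℝ => |e|) (by fun_prop) (hS.measurable_η 0)).symm

lemma measurable_width (hS : S.ScaleFamilyModel μ) (hw : IsWeight w) (α : ℝ) (n : ℕ) :
    Measurable fun ω => S.width w α n ω (S.Xtest n ω) := by
  have hX := hS.measurable_X
  exact ((hS.measurable_qhat hw α n).const_mul 2).div
    ((measurable_comp_leverage hw.continuousOn).comp (by fun_prop : Measurable fun ω =>
      (fun k : Fin (S.n₁ n) => S.X k ω, S.X (S.testIdx n) ω)))

variable [IsProbabilityMeasure μ] {Fh : Measure ℝ} {q : ℝ}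

lemma cdf_scoreLaw (hS : S.ScaleFamilyModel μ) (hw : IsWeight w) (t : ℝ) :
    cdf (S.scoreLaw μ w) t = cdf (μ.map fun ω => |S.η 0 ω|) (t / S.scoreScale w) := by
  have := hS.isProbabilityMeasure_noise
  rw [hS.map_abs_noise]
  exact cdf_map_const_mul_abs (hS.scoreScale_pos hw) t

lemma tendstoInMeasure_qhat (hS : S.ScaleFamilyModel μ) (hreg : S.Regular μ Fh)
    (hw : IsWeight w) (hα : α ∈ Set.Ioo (0 : ℝ) 1)
    (hunique : ∃! t, cdf (μ.map fun ω => |S.η 0 ω|) t = 1 - α)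
    (hq : cdf (μ.map fun ω => |S.η 0 ω|) q = 1 - α) :
    TendstoInMeasure μ (S.qhat w α) atTop fun _ => S.scoreScale w * q := by
  have hscale := (hS.scoreScale_pos hw).ne'
  have hlimit : cdf (S.scoreLaw μ w) (S.scoreScale w * q) = 1 - α := by
    rw [hS.cdf_scoreLaw hw, mul_div_cancel_left₀ _ hscale, hq]
  refine tendstoInMeasure_of_tendstoInMeasure_cdf ⟨_, hlimit, fun t ht => ?_⟩ hlimit
    (hS.tendstoInMeasure_cdf_qhat hreg hw hα)
  beta_reduce at ht
  rw [hS.cdf_scoreLaw hw] at ht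
  rw [← hunique.unique ht hq, mul_div_cancel₀ _ hscale]

lemma tendstoInMeasure_width (hS : S.ScaleFamilyModel μ) (hreg : S.Regular μ Fh)
    (hw : IsWeight w) (hα : α ∈ Set.Ioo (0 : ℝ) 1)
    (hunique : ∃! t, cdf (μ.map fun ω => |S.η 0 ω|) t = 1 - α)
    (hq : cdf (μ.map fun ω => |S.η 0 ω|) q = 1 - α) :
    TendstoInMeasure μ (fun n ω => S.width w α n ω (S.Xtest n ω)) atTop
      fun _ => 2 * (S.σ * √(S.g 0)) * q := by
  have hw₀ := (hw.pos 0 le_rfl).ne'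
  have hcont : Continuous fun v : ℝ × ℝ => w (max 0 v.2) :=
    (continuous_comp_max hw.continuousOn).comp continuous_snd
  have hlim := tendstoInMeasure_comp_of_continuousAt
    (G := fun v : ℝ × ℝ => 2 * v.1 / w (max 0 v.2))
    (ContinuousAt.div (by fun_prop) hcont.continuousAt (by simpa using hw₀))
    (tendstoInMeasure_prodMk (hS.tendstoInMeasure_qhat hreg hw hα hunique hq)
      (hS.tendstoInMeasure_htest hreg))
  have hlimit : 2 * (S.scoreScale w * q) / w 0 = 2 * (S.σ * √(S.g 0)) * q := by
    rw [scoreScale]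
    field_simp
  simp only [max_self, max_eq_right (htest_nonneg _ _), hlimit] at hlim
  exact hlim

lemma tendsto_integral_width (hS : S.ScaleFamilyModel μ) (hreg : S.Regular μ Fh)
    (hwidth : S.WidthRegular μ α) (hw : S.IsIntermediateWeight w) (hα : α ∈ Set.Ioo (0 : ℝ) 1)
    (hq : cdf (μ.map fun ω => |S.η 0 ω|) q = 1 - α) :
    (∀ᶠ n in atTop, Integrable (fun ω => S.width w α n ω (S.Xtest n ω)) μ) ∧
      Tendsto (fun n => ∫ ω, S.width w α n ω (S.Xtest n ω) ∂μ) atTop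
        (𝓝 (2 * (S.σ * √(S.g 0)) * q)) := by
  obtain ⟨B, hB⟩ := hwidth.noise_variance_bounded
  have hmeas := hS.measurable_width hw.toIsWeight α
  refine eventually_integrable_and_tendsto_integral hmeas ?_
  have hsignal (n : ℕ) :
      Measurable fun ω => (∑ i : Fin (S.n₂ n), S.signalBound n (S.n₁ n + i) ω) / S.n₂ n :=
    (Finset.measurable_fun_sum _ fun i _ => hS.measurable_signalBound n _).div_const _
  have hnoise (n : ℕ) :
      Measurable fun ω => (∑ i : Fin (S.n₂ n), S.noiseBound n (S.n₁ n + i) ω) / S.n₂ n :=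
    (Finset.measurable_fun_sum _ fun i _ => hS.measurable_noiseBound n _).div_const _
  refine tendsto_lintegral_enorm_sub
    (hS.tendstoInMeasure_width hreg hw.toIsWeight hα hwidth.quantile_unique hq) hmeas
    (fun n => (hsignal n).enorm.const_mul ‖4 / α‖ₑ) (fun n => (hnoise n).enorm.const_mul ‖4 / α‖ₑ)
    ?_ ?_ (K := ‖4 / α‖ₑ ^ 2 * (‖S.σ‖ₑ ^ 2 * (2 * ENNReal.ofReal B))) (by finiteness) ?_
  · filter_upwards [hS.eventually_width_le hreg.n₂_tendsto hw hα] with n hn ω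
    rw [← enorm_mul, ← enorm_mul]
    refine le_trans ?_ (enorm_add_le _ _)
    have hwidth₀ := width_nonneg (S := S) hw.toIsWeight α n ω (S.Xtest n ω)
    rw [Real.enorm_of_nonneg hwidth₀, Real.enorm_of_nonneg (hwidth₀.trans (hn ω))]
    exact ENNReal.ofReal_le_ofReal (hn ω)
  · simpa only [lintegral_const_mul _ (hsignal _).enorm, mul_zero] using
      ENNReal.Tendsto.const_mul (hS.tendsto_lintegral_average_signalBound hwidth)
        (.inr enorm_ne_top)
  · filter_upwards [hS.eventually_lintegral_average_noiseBound_sq_le hB] with n hn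
    simp only [mul_pow]
    rw [lintegral_const_mul _ ((hnoise n).enorm.pow_const 2)]
    gcongr

theorem width_parity (hS : S.ScaleFamilyModel μ) (hreg : S.Regular μ Fh)
    (hwidth : S.WidthRegular μ α) (hw : S.IsIntermediateWeight w)
    (hw' : S.IsIntermediateWeight w') (hα : α ∈ Set.Ioo (0 : ℝ) 1) :
    (∀ᶠ n in atTop, Integrable (fun ω => S.width w α n ω (S.Xtest n ω)) μ ∧
      Integrable (fun ω => S.width w' α n ω (S.Xtest n ω)) μ ∧
      0 < ∫ ω, S.width w' α n ω (S.Xtest n ω) ∂μ) ∧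
    Tendsto (fun n => (∫ ω, S.width w α n ω (S.Xtest n ω) ∂μ) /
      ∫ ω, S.width w' α n ω (S.Xtest n ω) ∂μ) atTop (𝓝 1) := by
  obtain ⟨q, hq, -⟩ := hwidth.quantile_unique
  have hnoise := hS.isProbabilityMeasure_noise
  have hq₀ : 0 < q := by
    refine pos_of_cdf_map_abs_pos hreg.cdf_cont ?_
    rw [← hS.map_abs_noise, hq]
    exact sub_pos.2 hα.2
  have hlimit : 0 < 2 * (S.σ * √(S.g 0)) * q := by
    have := hS.σ_pos
    have := hS.g_zero
    positivity
  obtain ⟨hintegrable, hlim⟩ := hS.tendsto_integral_width hreg hwidth hw hα hq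
  obtain ⟨hintegrable', hlim'⟩ := hS.tendsto_integral_width hreg hwidth hw' hα hq
  have hratio := hlim.div hlim' hlimit.ne'
  rw [div_self hlimit.ne'] at hratio
  refine ⟨?_, hratio⟩
  filter_upwards [hintegrable, hintegrable', hlim'.eventually_const_lt hlimit] with n hn hn' hpos
  exact ⟨hn, hn', hpos⟩

end WidthParity

end ScaleFamilyModel

end Setup

end LWCP

end

theorem mainTheorem2_general {Ω : Type*} [MeasurableSpace Ω] {μ : Measure Ω}
    [IsProbabilityMeasure μ] {p : ℕ} {S : LWCP.Setup Ω p} {Fh : Measure ℝ}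
    [IsProbabilityMeasure Fh] {α : ℝ} (hα : α ∈ Set.Ioo (0 : ℝ) 1)
    (hmodel : S.ScaleFamilyModel μ) (hreg : S.Regular μ Fh) :
    (∀ w, LWCP.IsWeight w →
      Tendsto (fun n => ∫ ω, |(μ⟦S.covered w α n |
        MeasurableSpace.comap (S.htest n) inferInstance⟧) ω - (1 - α)| ∂μ) atTop (𝓝 0) ∧
      (∀ᵐ t ∂Fh, ∀ r : ℝ, 0 < r →
        (∀ᶠ n in atTop, 0 < μ {ω | |S.htest n ω - t| < r}) ∧
        Tendsto (fun n => (μ[|{ω | |S.htest n ω - t| < r}]).real (S.covered w α n))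
          atTop (𝓝 (1 - α))) ∧
      (∀ᵐ t ∂Fh, ∀ ε : ℝ, 0 < ε →
        Tendsto (fun n => μ {ω | ∃ x, S.h n ω x = t ∧
          ε ≤ |S.coverageAt μ w α n ω x - (1 - α)|}) atTop (𝓝 0))) ∧
    (S.WidthRegular μ α → ∀ w w', S.IsIntermediateWeight w → S.IsIntermediateWeight w' →
      (∀ᶠ n in atTop,
        Integrable (fun ω => S.width w α n ω (S.Xtest n ω)) μ ∧
        Integrable (fun ω => S.width w' α n ω (S.Xtest n ω)) μ ∧
        0 < ∫ ω, S.width w' α n ω (S.Xtest n ω) ∂μ) ∧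
      Tendsto (fun n => (∫ ω, S.width w α n ω (S.Xtest n ω) ∂μ) /
        ∫ ω, S.width w' α n ω (S.Xtest n ω) ∂μ) atTop (𝓝 1)) := by
  obtain rfl := hmodel.eq_dirac_zero hreg
  simp only [ae_dirac_eq, eventually_pure]
  exact ⟨fun w hw => ⟨hmodel.tendsto_condExp_covered hreg hw hα,
      fun _ hr => hmodel.tendsto_cond_covered hreg hw hα hr,
      fun _ hε => hmodel.tendsto_coverageAt hreg hw hα hε⟩,
    fun hwidth _ _ hw hw' => hmodel.width_parity hreg hwidth hw hw' hα⟩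

theorem mainTheorem2 {Ω : Type*} [MeasurableSpace Ω] (μ : Measure Ω) [IsProbabilityMeasure μ]
    {p : ℕ} (S : LWCP.Setup Ω p) (Fh : Measure ℝ) [IsProbabilityMeasure Fh]
    (α : ℝ) (hα : α ∈ Set.Ioo (0 : ℝ) 1)
    (hmodel : S.ScaleFamilyModel μ) (hreg : S.Regular μ Fh) :
    -- Conditional coverage given the leverage of the test point: as a conditional probability,
    Tendsto (fun n => ∫ ω, |(μ⟦S.covered S.wstar α n | MeasurableSpace.comap (S.htest n) inferInstance⟧) ω
      - (1 - α)| ∂μ) atTop (𝓝 0) ∧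
    -- given that the leverage is close to `t`, for `Fh`-almost every `t`,
    (∀ᵐ t ∂Fh, ∀ r : ℝ, 0 < r →
      (∀ᶠ n in atTop, 0 < μ {ω | |S.htest n ω - t| < r}) ∧
      Tendsto (fun n => (μ[|{ω | |S.htest n ω - t| < r}]).real (S.covered S.wstar α n))
        atTop (𝓝 (1 - α))) ∧
    -- and given the data and a test feature vector of leverage exactly `t`, uniformly in the
    -- latter, in probability, for `Fh`-almost every `t`.
    (∀ᵐ t ∂Fh, ∀ ε : ℝ, 0 < ε →
      Tendsto (fun n => μ {ω | ∃ x, S.h n ω x = t ∧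
        ε ≤ |S.coverageAt μ S.wstar α n ω x - (1 - α)|}) atTop (𝓝 0)) ∧
    -- Width parity
    (S.WidthRegular μ α →
      (∀ᶠ n in atTop,
        Integrable (fun ω => S.width S.wstar α n ω (S.Xtest n ω)) μ ∧
        Integrable (fun ω => S.width (fun _ => 1) α n ω (S.Xtest n ω)) μ ∧
        0 < ∫ ω, S.width (fun _ => 1) α n ω (S.Xtest n ω) ∂μ) ∧
      Tendsto (fun n => (∫ ω, S.width S.wstar α n ω (S.Xtest n ω) ∂μ) /
        ∫ ω, S.width (fun _ => 1) α n ω (S.Xtest n ω) ∂μ) atTop (𝓝 1)) := by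
  obtain ⟨hcoverage, hparity⟩ := mainTheorem2_general hα hmodel hreg
  obtain ⟨hcondExp, hcond, hpointwise⟩ := hcoverage _ hmodel.isWeight_wstar
  exact ⟨hcondExp, hcond, hpointwise, fun hwidth => hparity hwidth _ _
    hmodel.isIntermediateWeight_wstar hmodel.isIntermediateWeight_one⟩
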